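/- Let $d\in\mathbb{N}$, let $Y\subset\mathbb{R}^d$ be compact, and let $\Phi=\{\phi_i\}_{i\in\mathcal{D}}$ be a finite family of maps $\phi_i:Y\to Y$ forming a conformal iterated function system on $Y$; that is, each $\phi_i$ extends to an injective $C^1$ contraction on some open connected set $V\supset Y$ whose differential satisfies $|\phi_i'(x)y|=|\phi_i'(x)||y|$ for all $x\in V$, $y\in\mathbb{R}^d$, with $0<\inf_{x\in V}|\phi_i'(x)|\le\sup_{x\in V}|\phi_i'(x)|<1$, and such that for some $\alpha,c>0$, $\big||\phi_i'(x)|-|\phi_i'(y)|\big|\le c|x-y|^{\alpha}$ for all $x,y\in V$. (Here a contraction on $V$ is a map for which there is $r\in(0,1)$ with $|\phi(x)-\phi(y)|\le r|x-y|$ for all $x,y\in V$.) Let $X\subset Y$ be its attractor, i.e. the unique non-empty compact subset of $Y$ with $X=\bigcup_{i\in\mathcal{D}}\phi_i(X)$, and assume the strong separation condition: $\phi_i(X)\cap\phi_j(X)=\emptyset$ for all $i\ne j$. For a finite word $I=(i_1,\dots,i_n)\in\mathcal{D}^n$, $n\ge1$, write $|I|=n$, $\phi_I=\phi_{i_1}\circ\cdots\circ\phi_{i_n}$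 and $X_I=\phi_I(X)$. For $z\in X$ and $\theta:\mathbb{N}\to\mathbb{R}_{\ge0}$ let $W(\theta,z)$ be the set of $x\in X$ such that $|x-\phi_I(z)|\le \mathrm{Diam}(X_I)\,\theta(|I|)$ for infinitely many words $I\in\bigcup_{n\ge1}\mathcal{D}^n$. Let $z\in X$, and let $\theta:\mathbb{N}\to\mathbb{R}_{\ge0}$ be any function (not necessarily monotone) such that $$\sum_{n=1}^{\infty}\sum_{I\in\mathcal{D}^n}\big(\mathrm{Diam}(X_I)\,\theta(n)\big)^{\dim_H(X)}=\infty$$ and, as $Q\to\infty$, $$\sum_{n=1}^{Q}\theta(n)^{\dim_H(X)}\log\frac{1}{\theta(n)}=O\Big(\Big(\sum_{n=1}^{Q}\theta(n)^{\dim_H(X)}\Big)^2\Big),$$ where a summand with $\theta(n)=0$ in the left-hand sum is read as $0$, and $0^0=1$. Then $\mathcal{H}^{\dim_H(X)}$-almost every $x\in X$ belongs to $W(\theta,z)$, where $\mathcal{H}^s$ denotes $s$-dimensional Hausdorff measure and $\dim_H$ Hausdorff dimension. -/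

import Mathlib

open Set Filter MeasureTheory
open scoped Topology Asymptotics

/-- `φ` (a total function whose values outside the domain in question are irrelevant) is an
injective conformal contraction on some open connected neighbourhood `V` of `Y`, with
`0 < inf_V ‖φ'‖ ≤ sup_V ‖φ'‖ < 1` and with `x ↦ ‖φ'(x)‖` Hölder continuous on `V`.
Here `φ'` is the differential, and its norm is the operator norm. -/
def IsConformalContractionNear {d : ℕ}
    (φ : EuclideanSpace ℝ (Fin d) → EuclideanSpace ℝ (Fin d))
    (Y : Set (EuclideanSpace ℝ (Fin d))) : Prop :=
  ∃ V : Set (EuclideanSpace ℝ (Fin d)),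
    IsOpen V ∧ IsConnected V ∧ Y ⊆ V ∧
    InjOn φ V ∧
    (∃ r : ℝ, 0 < r ∧ r < 1 ∧ ∀ x ∈ V, ∀ y ∈ V, dist (φ x) (φ y) ≤ r * dist x y) ∧
    ContDiffOn ℝ 1 φ V ∧
    (∀ x ∈ V, ∀ v : EuclideanSpace ℝ (Fin d), ‖fderiv ℝ φ x v‖ = ‖fderiv ℝ φ x‖ * ‖v‖) ∧
    (∃ a : ℝ, 0 < a ∧ ∀ x ∈ V, a ≤ ‖fderiv ℝ φ x‖) ∧
    (∃ b : ℝ, b < 1 ∧ ∀ x ∈ V, ‖fderiv ℝ φ x‖ ≤ b) ∧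
    (∃ α : ℝ, 0 < α ∧ ∃ c : ℝ, 0 < c ∧ ∀ x ∈ V, ∀ y ∈ V,
      |‖fderiv ℝ φ x‖ - ‖fderiv ℝ φ y‖| ≤ c * dist x y ^ α)

/-- The family `φ` is a conformal iterated function system on the compact set `Y`
(the index type is assumed finite where this is used). -/
structure IsConformalIFS {d : ℕ} {ι : Type*}
    (φ : ι → EuclideanSpace ℝ (Fin d) → EuclideanSpace ℝ (Fin d))
    (Y : Set (EuclideanSpace ℝ (Fin d))) : Prop where
  isCompact : IsCompact Y
  mapsTo : ∀ i, MapsTo (φ i) Y Y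
  conformal : ∀ i, IsConformalContractionNear (φ i) Y

/-- `X` is the attractor of the iterated function system `φ` on `Y`: the nonempty compact
subset of `Y` with `X = ⋃ i, φ i (X)`. -/
structure IsAttractor {d : ℕ} {ι : Type*}
    (φ : ι → EuclideanSpace ℝ (Fin d) → EuclideanSpace ℝ (Fin d))
    (Y X : Set (EuclideanSpace ℝ (Fin d))) : Prop where
  nonempty : X.Nonempty
  isCompact : IsCompact X
  subset : X ⊆ Y
  eq_iUnion : X = ⋃ i, φ i '' X

/-- The strong separation condition: the first-level images of `X` are pairwise disjoint. -/
def StrongSeparation {d : ℕ} {ι : Type*}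
    (φ : ι → EuclideanSpace ℝ (Fin d) → EuclideanSpace ℝ (Fin d))
    (X : Set (EuclideanSpace ℝ (Fin d))) : Prop :=
  ∀ i j, i ≠ j → Disjoint (φ i '' X) (φ j '' X)

/-- `wordMap φ [i₁, …, iₙ] = φ i₁ ∘ ⋯ ∘ φ iₙ`. -/
def wordMap {d : ℕ} {ι : Type*}
    (φ : ι → EuclideanSpace ℝ (Fin d) → EuclideanSpace ℝ (Fin d)) :
    List ι → EuclideanSpace ℝ (Fin d) → EuclideanSpace ℝ (Fin d)
  | [] => id
  | i :: I => φ i ∘ wordMap φ I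

/-- The diameter of the cylinder set `φ_I(X)`. -/
noncomputable def cylDiam {d : ℕ} {ι : Type*}
    (φ : ι → EuclideanSpace ℝ (Fin d) → EuclideanSpace ℝ (Fin d))
    (X : Set (EuclideanSpace ℝ (Fin d))) (I : List ι) : ℝ :=
  Metric.diam (wordMap φ I '' X)

/-- `W(Ψ, z)`: the points of `X` lying in the (closed) ball `B(φ_I(z), Ψ(I))` for infinitely
many nonempty finite words `I`. -/
def limsupSet {d : ℕ} {ι : Type*}
    (φ : ι → EuclideanSpace ℝ (Fin d) → EuclideanSpace ℝ (Fin d))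
    (X : Set (EuclideanSpace ℝ (Fin d))) (Ψ : List ι → ℝ)
    (z : EuclideanSpace ℝ (Fin d)) : Set (EuclideanSpace ℝ (Fin d)) :=
  {x | x ∈ X ∧
    {I : List ι | I ≠ [] ∧ x ∈ Metric.closedBall (wordMap φ I z) (Ψ I)}.Infinite}

/-!
The proof is a second moment argument with respect to `s`-dimensional Hausdorff measure `μ` on the
attractor `X`, where `s = dim X`.

*Geometry.* The Hölder condition on `‖φ'‖` and the mean value inequality, applied to `φ` and to its
inverse, show that `φ` scales the distances in a subset of `X` of diameter `t` by a constant up to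
a factor `exp (± C t ^ α)` (`IsConformalContractionNear.distortion`). As cylinders shrink
geometrically, the errors along a word are summable, so that each `φ_I` is a similarity on `X` of
ratio `diam X_I` up to a constant `L` (`IsAttractor.exists_isQuasiSelfSimilar`). Nothing else about
conformal maps is used.

*Measure.* If `t > s` then `X` is null for `t`-dimensional Hausdorff measure and has cheap finite
covers, and Moran's argument (`rpow_le_sum_diam_of_cover`) forces `∑ (diam X_I / L) ^ t < 1` over
the words of each length. Letting `t` decrease to `s` gives `∑ diam X_I ^ s ≤ L ^ s`, hence
`μ X < ∞`. If `μ X > 0`, then `μ (X_I)` is comparable to `diam X_I ^ s`, and `μ` is Ahlfors regular.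

*Second moments.* Let `F_n` be the union over `|I| = n` of `φ_I (X ∩ B(z, θ(n) / L))`. Inside a
cylinder `X_J` it has relative measure comparable to `θ(n) ^ s`. For `m > n`, the sets `F_n` and
`F_m` are quasi-independent as soon as cylinders of level `m - n` are shorter than `θ(n)`; this
excludes only `O(1 + log (1 / θ(n)))` values of `m`, for which `μ (F_n ∩ F_m) ≤ μ (F_n)` is enough:
the total contribution is the sum that the logarithm condition controls. The Chung–Erdős
inequality then shows that `⋃_{n ≥ N} F_n` fills a proportion of `X_J` that depends neither
on `J` nor on `N` (`IsQuasiSelfSimilar.exists_proportion_le`), and a set which misses a fixed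
proportion of every cylinder is null (`IsQuasiSelfSimilar.measure_eq_zero_of_cylinder_le`).
-/

/-! ### Distortion of a single conformal contraction -/

/-- The inverse of an injective conformal `C¹` map is defined near each value and has a derivative
of norm at most `‖φ'‖⁻¹` there. -/
theorem hasFDerivAt_invFunOn_of_conformal {d : ℕ}
    {φ : EuclideanSpace ℝ (Fin d) → EuclideanSpace ℝ (Fin d)}
    {V : Set (EuclideanSpace ℝ (Fin d))} (hV : IsOpen V) (hinj : InjOn φ V)
    (hC : ContDiffOn ℝ 1 φ V)
    (hconf : ∀ x ∈ V, ∀ v : EuclideanSpace ℝ (Fin d), ‖fderiv ℝ φ x v‖ = ‖fderiv ℝ φ x‖ * ‖v‖)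
    (hpos : ∀ x ∈ V, 0 < ‖fderiv ℝ φ x‖) {p : EuclideanSpace ℝ (Fin d)} (hp : p ∈ V) :
    φ '' V ∈ 𝓝 (φ p) ∧
    ∃ A : EuclideanSpace ℝ (Fin d) →L[ℝ] EuclideanSpace ℝ (Fin d),
      HasFDerivAt (Function.invFunOn φ V) A (φ p) ∧ ‖A‖ ≤ ‖fderiv ℝ φ p‖⁻¹ := by
  have hker : ∀ v, fderiv ℝ φ p v = 0 → v = 0 := by
    intro v hv
    have h := hconf p hp v
    rw [hv, norm_zero] at h
    rcases mul_eq_zero.1 h.symm with h | h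
    · exact absurd h (hpos p hp).ne'
    · exact norm_eq_zero.1 h
  have hi : Function.Injective (fderiv ℝ φ p).toLinearMap :=
    (injective_iff_map_eq_zero _).2 hker
  let e : EuclideanSpace ℝ (Fin d) ≃L[ℝ] EuclideanSpace ℝ (Fin d) :=
    (LinearEquiv.ofInjectiveEndo _ hi).toContinuousLinearEquiv
  have he : (e : EuclideanSpace ℝ (Fin d) →L[ℝ] EuclideanSpace ℝ (Fin d)) = fderiv ℝ φ p := by
    ext v
    rfl
  have hst : HasStrictFDerivAt φ (e : EuclideanSpace ℝ (Fin d) →L[ℝ] EuclideanSpace ℝ (Fin d)) p := by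
    rw [he]
    exact (hC.contDiffAt (hV.mem_nhds hp)).hasStrictFDerivAt (by norm_num)
  have hmap := hst.map_nhds_eq_of_equiv
  have hVp : V ∈ 𝓝 p := hV.mem_nhds hp
  have himg : φ '' V ∈ 𝓝 (φ p) := by
    rw [← hmap]
    exact image_mem_map hVp
  have hleft : ∀ x ∈ V, Function.invFunOn φ V (φ x) = x := fun x hx =>
    hinj.leftInvOn_invFunOn hx
  have hcont : ContinuousAt (Function.invFunOn φ V) (φ p) := by
    unfold ContinuousAt
    rw [hleft p hp, ← hmap, tendsto_map'_iff]
    refine tendsto_id.congr' ?_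
    filter_upwards [hVp] with x hx
    exact (hleft x hx).symm
  refine ⟨himg, (e.symm : EuclideanSpace ℝ (Fin d) →L[ℝ] EuclideanSpace ℝ (Fin d)), ?_, ?_⟩
  · refine HasFDerivAt.of_local_left_inverse hcont (by rw [hleft p hp]; exact hst.hasFDerivAt) ?_
    filter_upwards [himg] with y hy
    exact Function.invFunOn_eq hy
  · refine ContinuousLinearMap.opNorm_le_bound _ (by positivity) fun v => ?_
    have h := hconf p hp (e.symm v)
    rw [← he] at h
    simp only [ContinuousLinearEquiv.coe_coe, ContinuousLinearEquiv.apply_symm_apply] at h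
    rw [he] at h
    simp only [ContinuousLinearEquiv.coe_coe]
    rw [h, inv_mul_cancel_left₀ (hpos p hp).ne']

/-- A map that is injective on a compact set and locally expands distances by at least a
factor `a` there does so globally, for some smaller factor. -/
theorem exists_lower_lipschitz {E : Type*} [MetricSpace E] {φ : E → E} {X : Set E}
    (hX : IsCompact X) (hcont : ContinuousOn φ X) (hinj : InjOn φ X) {a δ : ℝ} (ha : 0 < a)
    (hδ : 0 < δ)
    (hloc : ∀ u ∈ X, ∀ v ∈ X, dist u v < δ → a * dist u v ≤ dist (φ u) (φ v)) :
    ∃ a' : ℝ, 0 < a' ∧ ∀ u ∈ X, ∀ v ∈ X, a' * dist u v ≤ dist (φ u) (φ v) := by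
  set K : Set (E × E) := (X ×ˢ X) ∩ {p | δ ≤ dist p.1 p.2} with hK
  have hKc : IsCompact K :=
    (hX.prod hX).inter_right (isClosed_le continuous_const (by fun_prop))
  have hf : ContinuousOn (fun p : E × E => dist (φ p.1) (φ p.2) / dist p.1 p.2) K := by
    refine ContinuousOn.div ?_ (by fun_prop) fun p hp => (hδ.trans_le hp.2).ne'
    have h1 : ContinuousOn (fun p : E × E => φ p.1) K :=
      hcont.comp continuousOn_fst fun p hp => hp.1.1
    have h2 : ContinuousOn (fun p : E × E => φ p.2) K :=
      hcont.comp continuousOn_snd fun p hp => hp.1.2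
    exact continuous_dist.comp_continuousOn (h1.prodMk h2)
  rcases K.eq_empty_or_nonempty with h0 | h0
  · refine ⟨a, ha, fun u hu v hv => hloc u hu v hv ?_⟩
    by_contra h
    exact (h0 ▸ (⟨⟨hu, hv⟩, not_lt.1 h⟩ : (u, v) ∈ K) : (u, v) ∈ (∅ : Set (E × E)))
  · obtain ⟨q, hq, hmin⟩ := hKc.exists_isMinOn h0 hf
    have hq0 : 0 < dist q.1 q.2 := hδ.trans_le hq.2
    have hq1 : 0 < dist (φ q.1) (φ q.2) := dist_pos.2 fun h =>
      (dist_pos.1 hq0) (hinj hq.1.1 hq.1.2 h)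
    refine ⟨min a (dist (φ q.1) (φ q.2) / dist q.1 q.2), lt_min ha (div_pos hq1 hq0),
      fun u hu v hv => ?_⟩
    by_cases h : dist u v < δ
    · exact (mul_le_mul_of_nonneg_right (min_le_left _ _) dist_nonneg).trans (hloc u hu v hv h)
    · have h1 : (u, v) ∈ K := ⟨⟨hu, hv⟩, not_lt.1 h⟩
      have h2 : dist (φ q.1) (φ q.2) / dist q.1 q.2 ≤ dist (φ u) (φ v) / dist u v := hmin h1
      have h3 : 0 < dist u v := hδ.trans_le (not_lt.1 h)
      calc _ ≤ dist (φ u) (φ v) / dist u v * dist u v :=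
            mul_le_mul_of_nonneg_right ((min_le_right _ _).trans h2) dist_nonneg
        _ = _ := div_mul_cancel₀ _ h3.ne'

/-- A bound by a constant factor at all scales `t` can be replaced by `exp (C * t ^ α)` at scales
bounded away from zero. -/
theorem exists_le_exp_mul_rpow {A δ α : ℝ} (hα : 0 < α) (hδ : 0 < δ) :
    ∃ C : ℝ, 0 ≤ C ∧ ∀ t, δ ≤ t → A ≤ Real.exp (C * t ^ α) := by
  refine ⟨|A| / δ ^ α, by positivity, fun t ht => ?_⟩
  have h1 : δ ^ α ≤ t ^ α := Real.rpow_le_rpow hδ.le ht hα.le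
  have h2 : 0 < δ ^ α := by positivity
  have h3 : |A| ≤ |A| / δ ^ α * t ^ α := by
    rw [div_mul_eq_mul_div, le_div_iff₀ h2]
    gcongr
  have h4 := Real.add_one_le_exp (|A| / δ ^ α * t ^ α)
  linarith [le_abs_self A]

/-- A Hölder function bounded below by `a > 0` varies by a factor `exp (C * t ^ α)` at most between
points at distance `s ≤ k * t`. -/
theorem le_mul_exp_of_abs_sub_le {g h a c s α t k : ℝ} (ha : 0 < a) (hah : a ≤ h) (hc : 0 < c)
    (hα : 0 < α) (hs : 0 ≤ s) (hk : 0 ≤ k) (ht : 0 ≤ t) (hst : s ≤ k * t)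
    (hgh : |g - h| ≤ c * s ^ α) : g ≤ h * Real.exp (c / a * k ^ α * t ^ α) := by
  have h1 : s ^ α ≤ k ^ α * t ^ α := by
    rw [← Real.mul_rpow hk ht]
    exact Real.rpow_le_rpow hs hst hα.le
  have h2 : g ≤ h + c * (k ^ α * t ^ α) := by
    have := (abs_le.1 hgh).2
    have := mul_le_mul_of_nonneg_left h1 hc.le
    linarith
  have h3 : c * (k ^ α * t ^ α) ≤ h * (c / a * k ^ α * t ^ α) := by
    have : c * (k ^ α * t ^ α) = a * (c / a * k ^ α * t ^ α) := by field_simp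
    rw [this]
    gcongr
  have h4 := mul_le_mul_of_nonneg_left (Real.add_one_le_exp (c / a * k ^ α * t ^ α)) (ha.le.trans hah)
  linarith

/-- Distortion estimate: on a compact subset `X` of the domain, a conformal contraction with
Hölder continuous `‖φ'‖` scales the distances in a subset of diameter `t` by `‖φ' w‖` up to a
factor `exp (± C t ^ α)`, where `w` is any point of that subset. -/
theorem IsConformalContractionNear.distortion {d : ℕ}
    {φ : EuclideanSpace ℝ (Fin d) → EuclideanSpace ℝ (Fin d)}
    {Y X : Set (EuclideanSpace ℝ (Fin d))} (hφ : IsConformalContractionNear φ Y)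
    (hX : IsCompact X) (hXY : X ⊆ Y) :
    ∃ r : ℝ, 0 < r ∧ r < 1 ∧ (∀ u ∈ X, ∀ v ∈ X, dist (φ u) (φ v) ≤ r * dist u v) ∧
    InjOn φ X ∧
    ∃ α : ℝ, 0 < α ∧ ∃ C : ℝ, 0 ≤ C ∧ ∃ g : EuclideanSpace ℝ (Fin d) → ℝ, (∀ w ∈ X, 0 < g w) ∧
      ∀ t, ∀ u ∈ X, ∀ v ∈ X, ∀ w ∈ X, dist u v ≤ t → dist u w ≤ t →
        g w * dist u v ≤ Real.exp (C * t ^ α) * dist (φ u) (φ v) ∧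
        dist (φ u) (φ v) ≤ Real.exp (C * t ^ α) * (g w * dist u v) := by
  obtain ⟨V, hVo, -, hYV, hinj, ⟨r, hr0, hr1, hr⟩, hC1, hconf, ⟨a, ha, hag⟩, ⟨b, hb1, hgb⟩,
    α, hα, c, hc, hHol⟩ := hφ
  have hXV : X ⊆ V := hXY.trans hYV
  refine ⟨r, hr0, hr1, fun u hu v hv => hr u (hXV hu) v (hXV hv), hinj.mono hXV, α, hα, ?_⟩
  have hpos : ∀ x ∈ V, 0 < ‖fderiv ℝ φ x‖ := fun x hx => ha.trans_le (hag x hx)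
  have hder : ∀ x ∈ V, HasFDerivAt φ (fderiv ℝ φ x) x := fun x hx =>
    ((hC1.contDiffAt (hVo.mem_nhds hx)).differentiableAt (by norm_num)).hasFDerivAt
  have hcont : ContinuousOn φ X := hC1.continuousOn.mono hXV
  have hopen : IsOpen (φ '' V) := by
    rw [isOpen_iff_mem_nhds]
    rintro _ ⟨p, hp, rfl⟩
    exact (hasFDerivAt_invFunOn_of_conformal hVo hinj hC1 hconf hpos hp).1
  obtain ⟨δ₁, hδ₁, hthick₁⟩ := hX.exists_thickening_subset_open hVo hXV
  obtain ⟨δ₂, hδ₂, hthick₂⟩ :=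
    (hX.image_of_continuousOn hcont).exists_thickening_subset_open hopen (image_mono hXV)
  set ψ := Function.invFunOn φ V with hψ
  have hψV : ∀ q ∈ φ '' V, ψ q ∈ V ∧ φ (ψ q) = q := fun q hq =>
    ⟨Function.invFunOn_mem hq, Function.invFunOn_eq hq⟩
  have hψφ : ∀ x ∈ V, ψ (φ x) = x := fun x hx => hinj.leftInvOn_invFunOn hx
  -- balls around `φ u` on which the inverse is defined
  have hball : ∀ u ∈ X, ∀ τ, τ < δ₂ → Metric.closedBall (φ u) τ ⊆ φ '' V := by
    intro u hu τ hτ q hq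
    exact hthick₂ (Metric.mem_thickening_iff.2
      ⟨φ u, mem_image_of_mem _ hu, (Metric.mem_closedBall.1 hq).trans_lt hτ⟩)
  -- the mean value inequality for the inverse
  have hmvt : ∀ u ∈ X, ∀ τ, τ < δ₂ → ∀ M,
      (∀ q ∈ Metric.closedBall (φ u) τ, ‖fderiv ℝ φ (ψ q)‖⁻¹ ≤ M) →
      ∀ q ∈ Metric.closedBall (φ u) τ, dist (ψ q) u ≤ M * dist q (φ u) := by
    intro u hu τ hτ M hM q hq
    have hτ0 : 0 ≤ τ := dist_nonneg.trans (Metric.mem_closedBall.1 hq)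
    have hd : ∀ q ∈ Metric.closedBall (φ u) τ, ∃ A : EuclideanSpace ℝ (Fin d) →L[ℝ]
        EuclideanSpace ℝ (Fin d), HasFDerivAt ψ A q ∧ ‖A‖ ≤ M := by
      intro q hq
      obtain ⟨hqV, hqe⟩ := hψV q (hball u hu τ hτ hq)
      obtain ⟨-, A, hA, hAn⟩ := hasFDerivAt_invFunOn_of_conformal hVo hinj hC1 hconf hpos hqV
      rw [hqe] at hA
      exact ⟨A, hA, hAn.trans (hM q hq)⟩
    choose! A hA hAM using hd
    have := (convex_closedBall (φ u) τ).norm_image_sub_le_of_norm_hasFDerivWithin_le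
      (fun q hq => (hA q hq).hasFDerivWithinAt) hAM (Metric.mem_closedBall_self hτ0) hq
    rwa [hψφ u (hXV hu), ← dist_eq_norm, ← dist_eq_norm] at this
  have hinvM : ∀ u ∈ X, ∀ τ, τ < δ₂ → ∀ q ∈ Metric.closedBall (φ u) τ,
      dist (ψ q) u ≤ a⁻¹ * dist q (φ u) := fun u hu τ hτ =>
    hmvt u hu τ hτ a⁻¹ fun q hq =>
      inv_anti₀ ha (hag _ (hψV q (hball u hu τ hτ hq)).1)
  have hdistV : ∀ u ∈ X, ∀ v ∈ X, dist (φ u) (φ v) ≤ dist u v := fun u hu v hv =>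
    (hr u (hXV hu) v (hXV hv)).trans (mul_le_of_le_one_left dist_nonneg hr1.le)
  obtain ⟨a', ha', hlow⟩ := exists_lower_lipschitz hX hcont (hinj.mono hXV) ha hδ₂ (by
    intro u hu v hv huv
    have h1 : dist (φ v) (φ u) < δ₂ := by
      rw [dist_comm]; exact (hdistV u hu v hv).trans_lt huv
    have h2 := hinvM u hu _ h1 (φ v) (Metric.mem_closedBall.2 le_rfl)
    rw [hψφ v (hXV hv), inv_mul_eq_div, le_div_iff₀ ha, dist_comm v, dist_comm (φ v)] at h2
    linarith)
  obtain ⟨C₁, hC₁, hC₁'⟩ := exists_le_exp_mul_rpow (A := a⁻¹) hα hδ₁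
  obtain ⟨C₂, hC₂, hC₂'⟩ := exists_le_exp_mul_rpow (A := a'⁻¹) hα hδ₂
  set C₃ := c / a * 2 ^ α with hC₃
  set C₄ := c / a * (a⁻¹ + 1) ^ α with hC₄
  have hC₃0 : 0 ≤ C₃ := by positivity
  have hC₄0 : 0 ≤ C₄ := by positivity
  refine ⟨C₁ + C₂ + C₃ + C₄, by positivity, fun x => ‖fderiv ℝ φ x‖,
    fun w hw => hpos w (hXV hw), ?_⟩
  intro t u hu v hv w hw huv huw
  have ht : 0 ≤ t := dist_nonneg.trans huv
  have htα : 0 ≤ t ^ α := by positivity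
  have hgw := hag w (hXV hw)
  have hgw1 := (hgb w (hXV hw)).trans hb1.le
  have hexp : ∀ C', C' ≤ C₁ + C₂ + C₃ + C₄ →
      Real.exp (C' * t ^ α) ≤ Real.exp ((C₁ + C₂ + C₃ + C₄) * t ^ α) := fun C' h => by gcongr
  constructor
  · rcases lt_or_ge t δ₂ with hlt | hge
    · have hτ : dist (φ v) (φ u) < δ₂ := by
        rw [dist_comm]; exact ((hdistV u hu v hv).trans huv).trans_lt hlt
      have hM : ∀ q ∈ Metric.closedBall (φ u) (dist (φ v) (φ u)),
          ‖fderiv ℝ φ (ψ q)‖⁻¹ ≤ Real.exp (C₄ * t ^ α) * ‖fderiv ℝ φ w‖⁻¹ := by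
        intro q hq
        have hqV := (hψV q (hball u hu _ hτ hq)).1
        have h1 : dist (ψ q) u ≤ a⁻¹ * t := by
          refine (hinvM u hu _ hτ q hq).trans ?_
          have := (Metric.mem_closedBall.1 hq)
          have := hdistV v hv u hu
          rw [dist_comm v u] at this
          gcongr
          linarith
        have h2 : dist w (ψ q) ≤ (a⁻¹ + 1) * t := by
          have := dist_triangle w u (ψ q)
          rw [dist_comm w u, dist_comm u (ψ q)] at this
          linarith
        have h3 := le_mul_exp_of_abs_sub_le ha (hag _ hqV) hc hα dist_nonneg
          (by positivity : (0:ℝ) ≤ a⁻¹ + 1) ht h2 (hHol w (hXV hw) _ hqV)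
        rw [← hC₄] at h3
        have h4 := hpos _ hqV
        have h5 := hpos _ (hXV hw)
        rw [← div_eq_mul_inv, le_div_iff₀ h5, inv_mul_eq_div, div_le_iff₀ h4]
        linarith
      have h6 := hmvt u hu _ hτ _ hM (φ v) (Metric.mem_closedBall.2 le_rfl)
      rw [hψφ v (hXV hv), dist_comm v, dist_comm (φ v), mul_right_comm, ← div_eq_mul_inv,
        le_div_iff₀ (hpos _ (hXV hw))] at h6
      calc _ ≤ Real.exp (C₄ * t ^ α) * dist (φ u) (φ v) := by linarith
        _ ≤ _ := by
          gcongr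
          linarith
    · have h1 := hlow u hu v hv
      calc ‖fderiv ℝ φ w‖ * dist u v ≤ 1 * dist u v := by gcongr
        _ = a'⁻¹ * (a' * dist u v) := by field_simp
        _ ≤ Real.exp (C₂ * t ^ α) * dist (φ u) (φ v) := by
          gcongr
          exact hC₂' t hge
        _ ≤ _ := by
          gcongr
          linarith
  · rcases lt_or_ge t δ₁ with hlt | hge
    · have hsub : Metric.closedBall u t ⊆ V := fun p hp =>
        hthick₁ (Metric.mem_thickening_iff.2 ⟨u, hu, (Metric.mem_closedBall.1 hp).trans_lt hlt⟩)
      have hM : ∀ p ∈ Metric.closedBall u t,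
          ‖fderiv ℝ φ p‖ ≤ ‖fderiv ℝ φ w‖ * Real.exp (C₃ * t ^ α) := by
        intro p hp
        refine le_mul_exp_of_abs_sub_le ha hgw hc hα dist_nonneg zero_le_two ht ?_
          (hHol p (hsub hp) w (hXV hw))
        have := dist_triangle p u w
        have := Metric.mem_closedBall.1 hp
        linarith
      have h6 := (convex_closedBall u t).norm_image_sub_le_of_norm_hasFDerivWithin_le
        (fun p hp => (hder p (hsub hp)).hasFDerivWithinAt) hM (Metric.mem_closedBall_self ht)
        (Metric.mem_closedBall.2 (by rw [dist_comm]; exact huv) : v ∈ _)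
      rw [← dist_eq_norm, ← dist_eq_norm, dist_comm v, dist_comm (φ v)] at h6
      calc _ ≤ Real.exp (C₃ * t ^ α) * (‖fderiv ℝ φ w‖ * dist u v) := by linarith
        _ ≤ _ := by
          gcongr
          linarith
    · calc dist (φ u) (φ v) ≤ dist u v := hdistV u hu v hv
        _ = a⁻¹ * (a * dist u v) := by field_simp
        _ ≤ Real.exp (C₁ * t ^ α) * (‖fderiv ℝ φ w‖ * dist u v) := by
          gcongr
          exact hC₁' t hge
        _ ≤ _ := by
          gcongr
          linarith

/-! ### Words and cylinder sets -/

section Words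

variable {d : ℕ} {ι : Type*} {φ : ι → EuclideanSpace ℝ (Fin d) → EuclideanSpace ℝ (Fin d)}
  {X A B : Set (EuclideanSpace ℝ (Fin d))}

theorem wordMap_append (I J : List ι) : wordMap φ (I ++ J) = wordMap φ I ∘ wordMap φ J := by
  induction I with
  | nil => rfl
  | cons i I ih => rw [List.cons_append, wordMap, ih, wordMap, Function.comp_assoc]

theorem mapsTo_wordMap (h : ∀ i, MapsTo (φ i) X X) (I : List ι) : MapsTo (wordMap φ I) X X := by
  induction I with
  | nil => exact mapsTo_id X
  | cons i I ih => exact (h i).comp ih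

/-- The Hutchinson operator `A ↦ ⋃ i, φ i (A)`. -/
def hutchinson (φ : ι → EuclideanSpace ℝ (Fin d) → EuclideanSpace ℝ (Fin d))
    (A : Set (EuclideanSpace ℝ (Fin d))) : Set (EuclideanSpace ℝ (Fin d)) :=
  ⋃ i, φ i '' A

theorem hutchinson_iterate_eq_iUnion (n : ℕ) (A : Set (EuclideanSpace ℝ (Fin d))) :
    (hutchinson φ)^[n] A = ⋃ I : Fin n → ι, wordMap φ (List.ofFn I) '' A := by
  induction n with
  | zero => simp [wordMap, iUnion_const]
  | succ n ih =>
    rw [Function.iterate_succ_apply', ih, hutchinson]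
    ext x
    simp only [mem_iUnion, mem_image]
    constructor
    · rintro ⟨i, y, ⟨I, a, ha, rfl⟩, rfl⟩
      exact ⟨Fin.cons i I, a, ha, by simp [List.ofFn_succ, wordMap]⟩
    · rintro ⟨I, a, ha, rfl⟩
      refine ⟨I 0, _, ⟨fun k => I k.succ, a, ha, rfl⟩, by simp [List.ofFn_succ, wordMap]⟩

theorem mem_hutchinson_iterate {n : ℕ} {x : EuclideanSpace ℝ (Fin d)} :
    x ∈ (hutchinson φ)^[n] A ↔ ∃ I : List ι, I.length = n ∧ x ∈ wordMap φ I '' A := by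
  rw [hutchinson_iterate_eq_iUnion, mem_iUnion]
  constructor
  · rintro ⟨I, hI⟩
    exact ⟨List.ofFn I, List.length_ofFn, hI⟩
  · rintro ⟨I, rfl, hI⟩
    exact ⟨I.get, by rwa [List.ofFn_get]⟩

theorem hutchinson_iterate_mono (n : ℕ) (h : A ⊆ B) :
    (hutchinson φ)^[n] A ⊆ (hutchinson φ)^[n] B := by
  intro x hx
  obtain ⟨I, hI, hx⟩ := mem_hutchinson_iterate.1 hx
  exact mem_hutchinson_iterate.2 ⟨I, hI, image_mono h hx⟩

theorem hutchinson_iterate_eq_self (hX : X = ⋃ i, φ i '' X) (n : ℕ) :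
    (hutchinson φ)^[n] X = X :=
  Function.iterate_fixed hX.symm n

/-- Two cylinders of the same level that meet are equal, and `φ_I` is injective on `X`. -/
theorem wordMap_inj (hX : X = ⋃ i, φ i '' X) (hinj : ∀ i, InjOn (φ i) X)
    (hsep : StrongSeparation φ X) {I J : List ι} (hIJ : I.length = J.length)
    {x y : EuclideanSpace ℝ (Fin d)} (hx : x ∈ X) (hy : y ∈ X)
    (h : wordMap φ I x = wordMap φ J y) : I = J ∧ x = y := by
  have hmaps : ∀ i, MapsTo (φ i) X X := fun i a ha => by
    rw [hX]; exact mem_iUnion.2 ⟨i, mem_image_of_mem _ ha⟩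
  induction I generalizing J with
  | nil =>
    cases J with
    | nil => exact ⟨rfl, h⟩
    | cons j J => simp at hIJ
  | cons i I ih =>
    cases J with
    | nil => simp at hIJ
    | cons j J =>
      simp only [wordMap, Function.comp_apply] at h
      have h1 := mapsTo_wordMap hmaps I hx
      have h2 := mapsTo_wordMap hmaps J hy
      have hij : i = j := by
        by_contra hne
        exact disjoint_left.1 (hsep i j hne) (mem_image_of_mem _ h1) (h ▸ mem_image_of_mem _ h2)
      subst hij
      obtain ⟨rfl, h3⟩ := ih (by simpa using hIJ) (hinj i h1 h2 h)
      exact ⟨rfl, h3⟩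

theorem hutchinson_iterate_inter (hX : X = ⋃ i, φ i '' X) (hinj : ∀ i, InjOn (φ i) X)
    (hsep : StrongSeparation φ X) (n : ℕ) (hA : A ⊆ X) (hB : B ⊆ X) :
    (hutchinson φ)^[n] A ∩ (hutchinson φ)^[n] B = (hutchinson φ)^[n] (A ∩ B) := by
  apply subset_antisymm
  · rintro x ⟨hxA, hxB⟩
    obtain ⟨I, hI, a, ha, rfl⟩ := mem_hutchinson_iterate.1 hxA
    obtain ⟨J, hJ, b, hb, hab⟩ := mem_hutchinson_iterate.1 hxB
    obtain ⟨rfl, rfl⟩ := wordMap_inj hX hinj hsep (hJ.trans hI.symm) (hB hb) (hA ha) hab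
    exact mem_hutchinson_iterate.2 ⟨J, hI, mem_image_of_mem _ ⟨ha, hb⟩⟩
  · exact subset_inter (hutchinson_iterate_mono n inter_subset_left)
      (hutchinson_iterate_mono n inter_subset_right)

/-- Inside the cylinder `X_J`, the set `hutchinson^[|J| + k] A` is the copy of
`hutchinson^[k] A` under `φ_J`. -/
theorem image_inter_hutchinson_iterate (hX : X = ⋃ i, φ i '' X) (hinj : ∀ i, InjOn (φ i) X)
    (hsep : StrongSeparation φ X) (J : List ι) (k : ℕ) (hA : A ⊆ X) :
    wordMap φ J '' X ∩ (hutchinson φ)^[J.length + k] A =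
      wordMap φ J '' ((hutchinson φ)^[k] A) := by
  have hk : (hutchinson φ)^[k] A ⊆ X := by
    rw [← hutchinson_iterate_eq_self hX k]
    exact hutchinson_iterate_mono k hA
  rw [Function.iterate_add_apply]
  apply subset_antisymm
  · rintro _ ⟨⟨x, hx, rfl⟩, hxA⟩
    obtain ⟨I, hI, a, ha, hax⟩ := mem_hutchinson_iterate.1 hxA
    obtain ⟨rfl, rfl⟩ := wordMap_inj hX hinj hsep hI (hk ha) hx hax
    exact mem_image_of_mem _ ha
  · exact subset_inter (image_mono hk) fun x hx => mem_hutchinson_iterate.2 ⟨J, rfl, hx⟩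

theorem pairwise_disjoint_image_wordMap (hX : X = ⋃ i, φ i '' X) (hinj : ∀ i, InjOn (φ i) X)
    (hsep : StrongSeparation φ X) (n : ℕ) (hA : A ⊆ X) :
    Pairwise (Function.onFun Disjoint fun I : Fin n → ι => wordMap φ (List.ofFn I) '' A) := by
  intro I J hIJ
  rw [Function.onFun, disjoint_left]
  rintro _ ⟨a, ha, rfl⟩ ⟨b, hb, hab⟩
  exact hIJ (List.ofFn_injective
    (wordMap_inj hX hinj hsep (by simp) (hA hb) (hA ha) hab).1.symm)

/-- A separated self-similar structure up to bounded distortion: each cylinder map `φ_I` is, up to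
the fixed factor `L`, a similarity on `X` of ratio `diam X_I`, and cylinder diameters decay
geometrically. -/
structure IsQuasiSelfSimilar (φ : ι → EuclideanSpace ℝ (Fin d) → EuclideanSpace ℝ (Fin d))
    (X : Set (EuclideanSpace ℝ (Fin d))) (L r : ℝ) : Prop where
  isCompact : IsCompact X
  nontrivial : X.Nontrivial
  eq_iUnion : X = ⋃ i, φ i '' X
  separation : StrongSeparation φ X
  one_le : 1 ≤ L
  pos : 0 < r
  lt_one : r < 1
  cylDiam_pos : ∀ I, 0 < cylDiam φ X I
  cylDiam_le : ∀ I : List ι, cylDiam φ X I ≤ Metric.diam X * r ^ I.length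
  lower : ∀ I, ∀ x ∈ X, ∀ y ∈ X,
    cylDiam φ X I / L * dist x y ≤ dist (wordMap φ I x) (wordMap φ I y)
  upper : ∀ I, ∀ x ∈ X, ∀ y ∈ X,
    dist (wordMap φ I x) (wordMap φ I y) ≤ L * cylDiam φ X I * dist x y

end Words

/-! ### Bounded distortion along words -/

section Distortion

variable {d : ℕ} {ι : Type*} {φ : ι → EuclideanSpace ℝ (Fin d) → EuclideanSpace ℝ (Fin d)}
  {X Y : Set (EuclideanSpace ℝ (Fin d))}

theorem dist_wordMap_le {r : ℝ} (hr0 : 0 < r) (hmaps : ∀ i, MapsTo (φ i) X X)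
    (hr : ∀ i, ∀ u ∈ X, ∀ v ∈ X, dist (φ i u) (φ i v) ≤ r * dist u v) (I : List ι) :
    ∀ x ∈ X, ∀ y ∈ X, dist (wordMap φ I x) (wordMap φ I y) ≤ r ^ I.length * dist x y := by
  induction I with
  | nil => intro x _ y _; simp [wordMap]
  | cons i I ih =>
    intro x hx y hy
    have h1 := hr i _ (mapsTo_wordMap hmaps I hx) _ (mapsTo_wordMap hmaps I hy)
    have h2 := mul_le_mul_of_nonneg_left (ih x hx y hy) hr0.le
    simp only [wordMap, Function.comp_apply, List.length_cons, pow_succ']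
    linarith

/-- Chaining the distortion estimate of the generators: the errors at the successive levels are
bounded by `ω (D r ^ k)`. -/
theorem exists_scaling_wordMap {r D : ℝ} (hr0 : 0 < r) (hne : X.Nonempty)
    (hmaps : ∀ i, MapsTo (φ i) X X)
    (hr : ∀ i, ∀ u ∈ X, ∀ v ∈ X, dist (φ i u) (φ i v) ≤ r * dist u v)
    (hD : ∀ u ∈ X, ∀ v ∈ X, dist u v ≤ D) {g : ι → EuclideanSpace ℝ (Fin d) → ℝ}
    (hg : ∀ i, ∀ w ∈ X, 0 < g i w) {ω : ℝ → ℝ}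
    (hω : ∀ i, ∀ t, ∀ u ∈ X, ∀ v ∈ X, ∀ w ∈ X, dist u v ≤ t → dist u w ≤ t →
        g i w * dist u v ≤ Real.exp (ω t) * dist (φ i u) (φ i v) ∧
        dist (φ i u) (φ i v) ≤ Real.exp (ω t) * (g i w * dist u v)) (I : List ι) :
    ∃ ρ : ℝ, 0 < ρ ∧ ∀ x ∈ X, ∀ y ∈ X,
      ρ * dist x y ≤ Real.exp (∑ k ∈ Finset.range I.length, ω (r ^ k * D)) *
        dist (wordMap φ I x) (wordMap φ I y) ∧
      dist (wordMap φ I x) (wordMap φ I y) ≤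
        Real.exp (∑ k ∈ Finset.range I.length, ω (r ^ k * D)) * (ρ * dist x y) := by
  induction I with
  | nil => exact ⟨1, one_pos, fun x _ y _ => by simp [wordMap]⟩
  | cons i I ih =>
    obtain ⟨ρ, hρ, h⟩ := ih
    obtain ⟨z, hz⟩ := hne
    have hX := fun x hx => mapsTo_wordMap hmaps I (x := x) hx
    have hd : ∀ x ∈ X, ∀ y ∈ X, dist (wordMap φ I x) (wordMap φ I y) ≤ r ^ I.length * D :=
      fun x hx y hy => (dist_wordMap_le hr0 hmaps hr I x hx y hy).trans
        (by gcongr; exact hD x hx y hy)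
    have hgz := hg i _ (hX z hz)
    refine ⟨g i (wordMap φ I z) * ρ, mul_pos hgz hρ, fun x hx y hy => ?_⟩
    obtain ⟨h1, h2⟩ := h x hx y hy
    obtain ⟨h3, h4⟩ := hω i _ _ (hX x hx) _ (hX y hy) _ (hX z hz) (hd x hx y hy) (hd x hx z hz)
    rw [List.length_cons, Finset.sum_range_succ, Real.exp_add]
    simp only [wordMap, Function.comp_apply]
    set S := Real.exp (∑ k ∈ Finset.range I.length, ω (r ^ k * D))
    have hS : 0 < S := Real.exp_pos _
    set e := Real.exp (ω (r ^ I.length * D))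
    have he : 0 < e := Real.exp_pos _
    constructor
    · calc _ = g i (wordMap φ I z) * (ρ * dist x y) := by ring
        _ ≤ g i (wordMap φ I z) * (S * dist (wordMap φ I x) (wordMap φ I y)) := by gcongr
        _ = S * (g i (wordMap φ I z) * dist (wordMap φ I x) (wordMap φ I y)) := by ring
        _ ≤ S * (e * dist (φ i (wordMap φ I x)) (φ i (wordMap φ I y))) := by gcongr
        _ = _ := by ring
    · calc _ ≤ e * (g i (wordMap φ I z) * dist (wordMap φ I x) (wordMap φ I y)) := h4
        _ ≤ e * (g i (wordMap φ I z) * (S * (ρ * dist x y))) := by gcongr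
        _ = _ := by ring

/-- The attractor of a strongly separated conformal iterated function system is self-similar up to
bounded distortion, unless it is a point. -/
theorem IsAttractor.exists_isQuasiSelfSimilar [Fintype ι] (hφ : IsConformalIFS φ Y)
    (hX : IsAttractor φ Y X) (hsep : StrongSeparation φ X) (hnt : X.Nontrivial) :
    ∃ L r : ℝ, IsQuasiSelfSimilar φ X L r := by
  have hmaps : ∀ i, MapsTo (φ i) X X := fun i a ha => by
    rw [hX.eq_iUnion]; exact mem_iUnion.2 ⟨i, mem_image_of_mem _ ha⟩
  choose r hr0 hr1 hr hinj α hα C hC g hg hdist using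
    fun i => IsConformalContractionNear.distortion (hφ.conformal i) hX.isCompact hX.subset
  have hne : Nonempty ι := by
    obtain ⟨x, hx⟩ := hX.nonempty
    rw [hX.eq_iUnion] at hx
    exact ⟨(mem_iUnion.1 hx).choose⟩
  obtain ⟨i₀, hi₀⟩ := Finite.exists_max r
  set R := r i₀
  have hR0 : 0 < R := hr0 i₀
  have hR1 : R < 1 := hr1 i₀
  have hrR : ∀ i, ∀ u ∈ X, ∀ v ∈ X, dist (φ i u) (φ i v) ≤ R * dist u v := fun i u hu v hv =>
    (hr i u hu v hv).trans (by gcongr; exact hi₀ i)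
  set D := Metric.diam X
  have hD : ∀ u ∈ X, ∀ v ∈ X, dist u v ≤ D := fun u hu v hv =>
    Metric.dist_le_diam_of_mem hX.isCompact.isBounded hu hv
  have hD0 : 0 < D := by
    obtain ⟨x, hx, y, hy, hxy⟩ := hnt
    exact (dist_pos.2 hxy).trans_le (hD x hx y hy)
  -- the sum of the moduli of the generators is a modulus valid for all of them
  set ω : ℝ → ℝ := fun t => ∑ i, C i * t ^ α i with hωdef
  have hω : ∀ i, ∀ t, ∀ u ∈ X, ∀ v ∈ X, ∀ w ∈ X, dist u v ≤ t → dist u w ≤ t →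
        g i w * dist u v ≤ Real.exp (ω t) * dist (φ i u) (φ i v) ∧
        dist (φ i u) (φ i v) ≤ Real.exp (ω t) * (g i w * dist u v) := by
    intro i t u hu v hv w hw huv huw
    have ht : 0 ≤ t := dist_nonneg.trans huv
    have hle : C i * t ^ α i ≤ ω t :=
      Finset.single_le_sum (f := fun i => C i * t ^ α i)
        (fun j _ => mul_nonneg (hC j) (Real.rpow_nonneg ht _)) (Finset.mem_univ i)
    obtain ⟨h1, h2⟩ := hdist i t u hu v hv w hw huv huw
    have hgw := hg i w hw
    exact ⟨h1.trans (by gcongr), h2.trans (by gcongr)⟩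
  have hω0 : ∀ k, 0 ≤ ω (R ^ k * D) := fun k =>
    Finset.sum_nonneg fun j _ => mul_nonneg (hC j) (by positivity)
  have hsum : Summable fun k : ℕ => ω (R ^ k * D) := by
    refine summable_sum fun i _ => ?_
    have heq : ∀ k : ℕ, C i * (R ^ k * D) ^ α i = C i * D ^ α i * (R ^ α i) ^ k := by
      intro k
      rw [Real.mul_rpow (by positivity) hD0.le, ← Real.rpow_natCast, ← Real.rpow_natCast,
        ← Real.rpow_mul hR0.le, ← Real.rpow_mul hR0.le, mul_comm (k : ℝ)]
      ring
    simp_rw [heq]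
    exact (summable_geometric_of_lt_one (by positivity)
      (Real.rpow_lt_one hR0.le hR1 (hα i))).mul_left _
  set K := Real.exp (∑' k, ω (R ^ k * D))
  have hK : ∀ n, Real.exp (∑ k ∈ Finset.range n, ω (R ^ k * D)) ≤ K := fun n =>
    Real.exp_le_exp.2 (hsum.sum_le_tsum _ fun k _ => hω0 k)
  have hK1 : 1 ≤ K := Real.one_le_exp (tsum_nonneg hω0)
  have key : ∀ I : List ι, ∃ ρ : ℝ, 0 < ρ ∧ ∀ x ∈ X, ∀ y ∈ X,
      ρ * dist x y ≤ K * dist (wordMap φ I x) (wordMap φ I y) ∧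
      dist (wordMap φ I x) (wordMap φ I y) ≤ K * (ρ * dist x y) := by
    intro I
    obtain ⟨ρ, hρ, h⟩ := exists_scaling_wordMap hR0 hX.nonempty hmaps hrR hD hg hω I
    refine ⟨ρ, hρ, fun x hx y hy => ⟨(h x hx y hy).1.trans ?_, (h x hx y hy).2.trans ?_⟩⟩
    · gcongr
      exact hK _
    · gcongr
      exact hK _
  choose ρ hρ hlow using key
  have hbdd : ∀ I, Bornology.IsBounded (wordMap φ I '' X) := fun I =>
    hX.isCompact.isBounded.subset (mapsTo_wordMap hmaps I).image_subset
  have hdI : ∀ I, ∀ x ∈ X, ∀ y ∈ X, dist (wordMap φ I x) (wordMap φ I y) ≤ cylDiam φ X I :=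
    fun I x hx y hy =>
      Metric.dist_le_diam_of_mem (hbdd I) (mem_image_of_mem _ hx) (mem_image_of_mem _ hy)
  have h1 : ∀ I, cylDiam φ X I ≤ K * (ρ I * D) := by
    intro I
    have := hρ I
    refine Metric.diam_le_of_forall_dist_le (by positivity) ?_
    rintro _ ⟨x, hx, rfl⟩ _ ⟨y, hy, rfl⟩
    exact (hlow I x hx y hy).2.trans (by gcongr; exact hD x hx y hy)
  have h2 : ∀ I, ρ I * D ≤ K * cylDiam φ X I := by
    intro I
    have := hρ I
    rw [mul_comm, ← le_div_iff₀ this]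
    refine Metric.diam_le_of_forall_dist_le
      (div_nonneg (mul_nonneg (by positivity) Metric.diam_nonneg) this.le) ?_
    intro x hx y hy
    rw [le_div_iff₀ this, mul_comm]
    exact (hlow I x hx y hy).1.trans (by gcongr; exact hdI I x hx y hy)
  have hpos : ∀ I, 0 < cylDiam φ X I := fun I =>
    pos_of_mul_pos_right ((mul_pos (hρ I) hD0).trans_le (h2 I)) (by positivity)
  have hL : (0 : ℝ) < K ^ 2 * (1 + D + D⁻¹) := by positivity
  refine ⟨K ^ 2 * (1 + D + D⁻¹), R, ⟨hX.isCompact, hnt, hX.eq_iUnion, hsep, ?_, hR0, hR1, hpos,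
    ?_, ?_, ?_⟩⟩
  · have : 0 < D⁻¹ := inv_pos.2 hD0
    have : 1 ≤ K ^ 2 := one_le_pow₀ hK1
    nlinarith
  · intro I
    refine Metric.diam_le_of_forall_dist_le (by positivity) ?_
    rintro _ ⟨x, hx, rfl⟩ _ ⟨y, hy, rfl⟩
    have h3 := dist_wordMap_le hR0 hmaps hrR I x hx y hy
    have h4 := mul_le_mul_of_nonneg_left (hD x hx y hy) (pow_pos hR0 I.length).le
    linarith
  · intro I x hx y hy
    rw [div_mul_eq_mul_div, div_le_iff₀ hL]
    calc cylDiam φ X I * dist x y ≤ K * (ρ I * D) * dist x y := by gcongr; exact h1 I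
      _ = K * D * (ρ I * dist x y) := by ring
      _ ≤ K * D * (K * dist (wordMap φ I x) (wordMap φ I y)) := by
        exact mul_le_mul_of_nonneg_left (hlow I x hx y hy).1 (by positivity)
      _ = dist (wordMap φ I x) (wordMap φ I y) * (K ^ 2 * D) := by ring
      _ ≤ _ := by
        gcongr
        have : 0 < D⁻¹ := inv_pos.2 hD0
        linarith
  · intro I x hx y hy
    calc _ ≤ K * (ρ I * dist x y) := (hlow I x hx y hy).2
      _ = K * D⁻¹ * (ρ I * D) * dist x y := by field_simp
      _ ≤ K * D⁻¹ * (K * cylDiam φ X I) * dist x y :=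
        mul_le_mul_of_nonneg_right (mul_le_mul_of_nonneg_left (h2 I) (by positivity)) dist_nonneg
      _ = K ^ 2 * D⁻¹ * cylDiam φ X I * dist x y := by ring
      _ ≤ _ := by
        have := (hpos I).le
        gcongr
        linarith

end Distortion

/-! ### Finiteness of the critical Hausdorff measure -/

/-- Moran's covering argument: if maps `ψ k` expand from `X` at least by `c k` with
`∑ k, c k ^ t ≥ 1`, and their images of `X` are `η`-separated, then no finite cover of `X` has
`∑ diam ^ t < η ^ t`. A cover by sets of diameter less than `η` splits into covers of the pieces
`ψ k (X)`; pulling these back gives smaller covers of `X`, one of which is no more expensive. -/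
theorem rpow_le_sum_diam_of_cover {E κ α : Type*} [PseudoMetricSpace E] [Fintype κ] [Nontrivial κ]
    {ψ : κ → E → E} {X : Set E} {c : κ → ℝ} {η t : ℝ} (hX : Bornology.IsBounded X)
    (hne : X.Nonempty) (hmaps : ∀ k, MapsTo (ψ k) X X) (hc : ∀ k, 0 < c k)
    (hlow : ∀ k, ∀ x ∈ X, ∀ y ∈ X, c k * dist x y ≤ dist (ψ k x) (ψ k y))
    (hη : 0 < η) (hsep : ∀ k l, k ≠ l → ∀ x ∈ X, ∀ y ∈ X, η ≤ dist (ψ k x) (ψ l y))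
    (ht : 0 ≤ t) (hsum : 1 ≤ ∑ k, c k ^ t) (s : Finset α) (U : α → Set E)
    (hU : X ⊆ ⋃ i ∈ s, U i) : η ^ t ≤ ∑ i ∈ s, Metric.diam (U i ∩ X) ^ t := by
  classical
  induction hn : s.card using Nat.strong_induction_on generalizing s U with
  | _ n ih =>
  have hbd : ∀ i, Bornology.IsBounded (U i ∩ X) := fun i => hX.subset inter_subset_right
  by_cases hbig : ∃ i ∈ s, η ≤ Metric.diam (U i ∩ X)
  · obtain ⟨i, hi, hηi⟩ := hbig
    calc η ^ t ≤ Metric.diam (U i ∩ X) ^ t := Real.rpow_le_rpow hη.le hηi ht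
      _ ≤ _ := Finset.single_le_sum (f := fun i => Metric.diam (U i ∩ X) ^ t)
        (fun j _ => Real.rpow_nonneg Metric.diam_nonneg _) hi
  push Not at hbig
  set S : κ → Finset α := fun k => s.filter fun i => (U i ∩ ψ k '' X).Nonempty with hS
  have hcov : ∀ k, ∀ x ∈ X, ∃ i ∈ S k, ψ k x ∈ U i := by
    intro k x hx
    obtain ⟨i, hi, hxi⟩ := mem_iUnion₂.1 (hU (hmaps k hx))
    exact ⟨i, Finset.mem_filter.2 ⟨hi, _, hxi, mem_image_of_mem _ hx⟩, hxi⟩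
  have hdisj : ∀ k l, k ≠ l → Disjoint (S k) (S l) := by
    intro k l hkl
    rw [Finset.disjoint_left]
    intro i hik hil
    obtain ⟨hi, _, hx, x, hxX, rfl⟩ := Finset.mem_filter.1 hik
    obtain ⟨-, _, hy, y, hyX, rfl⟩ := Finset.mem_filter.1 hil
    have h1 := Metric.dist_le_diam_of_mem (hbd i) ⟨hx, hmaps k hxX⟩ ⟨hy, hmaps l hyX⟩
    exact absurd (hbig i hi) (not_lt.2 ((hsep k l hkl x hxX y hyX).trans h1))
  have hSne : ∀ k, (S k).Nonempty := by
    intro k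
    obtain ⟨x, hx⟩ := hne
    obtain ⟨i, hi, -⟩ := hcov k x hx
    exact ⟨i, hi⟩
  have hcard : ∀ k, (S k).card < s.card := by
    intro k
    obtain ⟨l, hl⟩ := exists_ne k
    obtain ⟨j, hj⟩ := hSne l
    refine Finset.card_lt_card ((Finset.ssubset_iff_of_subset (Finset.filter_subset _ _)).2
      ⟨j, (Finset.mem_filter.1 hj).1, fun hjk => ?_⟩)
    exact Finset.disjoint_left.1 (hdisj l k hl) hj hjk
  have hk : ∀ k, c k ^ t * η ^ t ≤ ∑ i ∈ S k, Metric.diam (U i ∩ X) ^ t := by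
    intro k
    have h1 := ih _ (hn ▸ hcard k) (S k) (fun i => ψ k ⁻¹' U i)
      (fun x hx => by
        obtain ⟨i, hi, hxi⟩ := hcov k x hx
        exact mem_iUnion₂.2 ⟨i, hi, hxi⟩) rfl
    have h2 : ∀ i, c k ^ t * Metric.diam (ψ k ⁻¹' U i ∩ X) ^ t ≤ Metric.diam (U i ∩ X) ^ t := by
      intro i
      rw [← Real.mul_rpow (hc k).le Metric.diam_nonneg]
      refine Real.rpow_le_rpow (mul_nonneg (hc k).le Metric.diam_nonneg) ?_ ht
      rw [mul_comm, ← le_div_iff₀ (hc k)]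
      refine Metric.diam_le_of_forall_dist_le (div_nonneg Metric.diam_nonneg (hc k).le) ?_
      rintro x ⟨hx, hxX⟩ y ⟨hy, hyX⟩
      rw [le_div_iff₀ (hc k), mul_comm]
      exact (hlow k x hxX y hyX).trans
        (Metric.dist_le_diam_of_mem (hbd i) ⟨hx, hmaps k hxX⟩ ⟨hy, hmaps k hyX⟩)
    calc _ ≤ c k ^ t * ∑ i ∈ S k, Metric.diam (ψ k ⁻¹' U i ∩ X) ^ t :=
          mul_le_mul_of_nonneg_left h1 (Real.rpow_nonneg (hc k).le _)
      _ ≤ _ := by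
          rw [Finset.mul_sum]
          exact Finset.sum_le_sum fun i _ => h2 i
  calc η ^ t = 1 * η ^ t := (one_mul _).symm
    _ ≤ (∑ k, c k ^ t) * η ^ t := by gcongr
    _ = ∑ k, c k ^ t * η ^ t := Finset.sum_mul _ _ _
    _ ≤ ∑ k, ∑ i ∈ S k, Metric.diam (U i ∩ X) ^ t := Finset.sum_le_sum fun k _ => hk k
    _ = ∑ i ∈ Finset.univ.biUnion S, Metric.diam (U i ∩ X) ^ t :=
        (Finset.sum_biUnion fun k _ l _ h => hdisj k l h).symm
    _ ≤ _ := Finset.sum_le_sum_of_subset_of_nonneg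
        (Finset.biUnion_subset.2 fun k _ => Finset.filter_subset _ _)
        fun i _ _ => Real.rpow_nonneg Metric.diam_nonneg _

/-- A compact set of Hausdorff measure zero has finite covers with arbitrarily small sum
of powers of the diameters. -/
theorem exists_finite_cover_of_hausdorffMeasure_eq_zero {E : Type*} [MetricSpace E]
    [MeasurableSpace E] [BorelSpace E] {X : Set E} (hX : IsCompact X) {t : ℝ} (ht : 0 < t)
    (h0 : μH[t] X = 0) {ε : ℝ} (hε : 0 < ε) :
    ∃ (s : Finset ℕ) (U : ℕ → Set E), X ⊆ ⋃ i ∈ s, U i ∧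
      ∑ i ∈ s, Metric.diam (U i ∩ X) ^ t < ε := by
  have hε' : (0 : ENNReal) < ENNReal.ofReal (ε / 2) := ENNReal.ofReal_pos.2 (by linarith)
  rw [Measure.hausdorffMeasure_apply] at h0
  have h1 : (⨅ (T : ℕ → Set E) (_ : X ⊆ ⋃ n, T n) (_ : ∀ n, Metric.ediam (T n) ≤ 1),
      ∑' n, ⨆ _ : (T n).Nonempty, Metric.ediam (T n) ^ t) = 0 :=
    le_antisymm (h0 ▸ le_iSup₂ (f := fun (r : ENNReal) (_ : 0 < r) =>
      ⨅ (T : ℕ → Set E) (_ : X ⊆ ⋃ n, T n) (_ : ∀ n, Metric.ediam (T n) ≤ r),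
      ∑' n, ⨆ _ : (T n).Nonempty, Metric.ediam (T n) ^ t) 1 one_pos) zero_le
  rw [← h1] at hε'
  simp only [iInf_lt_iff] at hε'
  obtain ⟨T, hTX, hT1, hT⟩ := hε'
  have hTsum : ∑' n, Metric.ediam (T n) ^ t < ENNReal.ofReal (ε / 2) := by
    refine lt_of_le_of_lt (ENNReal.tsum_le_tsum fun n => ?_) hT
    rcases (T n).eq_empty_or_nonempty with h | h
    · simp [h, ht]
    · simp [h]
  obtain ⟨e, he, hesum⟩ := ENNReal.exists_pos_sum_of_countable'
    (ENNReal.ofReal_pos.2 (by linarith : 0 < ε / 2)).ne' ℕ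
  -- fatten each set of the cover slightly, to make it open
  have hfat : ∀ n, ∃ δ : NNReal, 0 < δ ∧
      Metric.ediam (Metric.thickening (δ : ℝ) (T n)) ^ t ≤ Metric.ediam (T n) ^ t + e n := by
    intro n
    have hfin : Metric.ediam (T n) ^ t ≠ ⊤ :=
      ENNReal.rpow_ne_top_of_nonneg ht.le (ne_top_of_le_ne_top ENNReal.one_ne_top (hT1 n))
    have hlim : Tendsto (fun δ : NNReal => (Metric.ediam (T n) + 2 * (δ : ENNReal)) ^ t) (𝓝 0)
        (𝓝 (Metric.ediam (T n) ^ t)) := by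
      have hc : Continuous fun δ : NNReal => (Metric.ediam (T n) + 2 * (δ : ENNReal)) ^ t := by
        refine ENNReal.continuous_rpow_const.comp (continuous_const.add ?_)
        exact (ENNReal.continuous_const_mul (by simp)).comp ENNReal.continuous_coe
      simpa using hc.tendsto 0
    have hev := hlim.eventually (gt_mem_nhds (ENNReal.lt_add_right hfin (he n).ne'))
    have hev' : ∀ᶠ δ : NNReal in 𝓝[>] 0,
        (Metric.ediam (T n) + 2 * (δ : ENNReal)) ^ t < Metric.ediam (T n) ^ t + e n :=
      hev.filter_mono nhdsWithin_le_nhds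
    obtain ⟨δ, hδ, hδ0⟩ := (hev'.and self_mem_nhdsWithin).exists
    exact ⟨δ, hδ0, (ENNReal.rpow_le_rpow (Metric.ediam_thickening_le δ) ht.le).trans hδ.le⟩
  choose δ hδ hδT using hfat
  obtain ⟨s, hs⟩ := hX.elim_finite_subcover (fun n => Metric.thickening (δ n : ℝ) (T n))
    (fun n => Metric.isOpen_thickening)
    (hTX.trans (iUnion_mono fun n => Metric.self_subset_thickening (hδ n) _))
  refine ⟨s, _, hs, ?_⟩
  rw [← ENNReal.ofReal_lt_ofReal_iff hε]
  calc ENNReal.ofReal (∑ i ∈ s, Metric.diam (Metric.thickening (δ i : ℝ) (T i) ∩ X) ^ t)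
      = ∑ i ∈ s, Metric.ediam (Metric.thickening (δ i : ℝ) (T i) ∩ X) ^ t := by
        rw [ENNReal.ofReal_sum_of_nonneg fun i _ => Real.rpow_nonneg Metric.diam_nonneg _]
        refine Finset.sum_congr rfl fun i _ => ?_
        rw [← ENNReal.ofReal_rpow_of_nonneg Metric.diam_nonneg ht.le, Metric.diam,
          ENNReal.ofReal_toReal (hX.isBounded.subset inter_subset_right).ediam_ne_top]
    _ ≤ ∑ i ∈ s, (Metric.ediam (T i) ^ t + e i) := Finset.sum_le_sum fun i _ =>
        (ENNReal.rpow_le_rpow (Metric.ediam_mono inter_subset_left) ht.le).trans (hδT i)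
    _ ≤ ∑' i, (Metric.ediam (T i) ^ t + e i) := ENNReal.sum_le_tsum _
    _ = ∑' i, Metric.ediam (T i) ^ t + ∑' i, e i := ENNReal.tsum_add
    _ < ENNReal.ofReal (ε / 2) + ENNReal.ofReal (ε / 2) := ENNReal.add_lt_add hTsum hesum
    _ = ENNReal.ofReal ε := by
        rw [← ENNReal.ofReal_add (by linarith) (by linarith), add_halves]

/-- Finitely many pairwise disjoint compact sets are uniformly separated. -/
theorem exists_pos_le_dist_of_pairwise_disjoint {E κ : Type*} [MetricSpace E] [Finite κ]
    {S : κ → Set E} (hS : ∀ k, IsCompact (S k)) (hd : ∀ k l, k ≠ l → Disjoint (S k) (S l)) :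
    ∃ η : ℝ, 0 < η ∧ ∀ k l, k ≠ l → ∀ x ∈ S k, ∀ y ∈ S l, η ≤ dist x y := by
  have h : ∀ p : κ × κ, ∃ η : ℝ, 0 < η ∧ (p.1 ≠ p.2 → ∀ x ∈ S p.1, ∀ y ∈ S p.2, η ≤ dist x y) := by
    intro p
    by_cases hp : p.1 = p.2
    · exact ⟨1, one_pos, fun h => absurd hp h⟩
    · obtain ⟨r, hr, h⟩ := Metric.exists_pos_forall_lt_edist (hS p.1) (hS p.2).isClosed (hd _ _ hp)
      refine ⟨r, hr, fun _ x hx y hy => ?_⟩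
      have := (h x hx y hy).le
      rw [edist_nndist, ENNReal.coe_le_coe] at this
      exact_mod_cast this
  choose η hη hη' using h
  cases isEmpty_or_nonempty κ
  · exact ⟨1, one_pos, fun k => isEmptyElim k⟩
  · obtain ⟨p, hp⟩ := Finite.exists_min η
    exact ⟨η p, hη p, fun k l hkl x hx y hy => (hp (k, l)).trans (hη' (k, l) hkl x hx y hy)⟩

namespace IsQuasiSelfSimilar

variable {d : ℕ} {ι : Type*} {φ : ι → EuclideanSpace ℝ (Fin d) → EuclideanSpace ℝ (Fin d)}
  {X A B : Set (EuclideanSpace ℝ (Fin d))} {L r : ℝ}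

theorem mapsTo (h : IsQuasiSelfSimilar φ X L r) (i : ι) : MapsTo (φ i) X X := fun a ha => by
  rw [h.eq_iUnion]; exact mem_iUnion.2 ⟨i, mem_image_of_mem _ ha⟩

theorem mapsTo_word (h : IsQuasiSelfSimilar φ X L r) (I : List ι) : MapsTo (wordMap φ I) X X :=
  mapsTo_wordMap h.mapsTo I

theorem pos_L (h : IsQuasiSelfSimilar φ X L r) : 0 < L := one_pos.trans_le h.one_le

theorem nonempty (h : IsQuasiSelfSimilar φ X L r) : X.Nonempty := h.nontrivial.nonempty

theorem diam_pos (h : IsQuasiSelfSimilar φ X L r) : 0 < Metric.diam X := by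
  simpa [cylDiam, wordMap] using h.cylDiam_pos []

theorem injOn_word (h : IsQuasiSelfSimilar φ X L r) (I : List ι) : InjOn (wordMap φ I) X := by
  intro x hx y hy hxy
  have h1 := h.lower I x hx y hy
  rw [hxy, dist_self] at h1
  have h2 : 0 < cylDiam φ X I / L := div_pos (h.cylDiam_pos I) h.pos_L
  by_contra hne
  exact absurd h1 (not_le.2 (mul_pos h2 (dist_pos.2 hne)))

theorem injOn (h : IsQuasiSelfSimilar φ X L r) (i : ι) : InjOn (φ i) X := by
  simpa [wordMap] using h.injOn_word [i]

theorem lipschitzOnWith (h : IsQuasiSelfSimilar φ X L r) (I : List ι) :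
    LipschitzOnWith (L * cylDiam φ X I).toNNReal (wordMap φ I) X := by
  refine LipschitzOnWith.of_dist_le_mul fun x hx y hy => ?_
  rw [Real.coe_toNNReal _ (mul_nonneg h.pos_L.le (h.cylDiam_pos I).le)]
  exact h.upper I x hx y hy

theorem isCompact_image (h : IsQuasiSelfSimilar φ X L r) (I : List ι) (hA : IsCompact A)
    (hAX : A ⊆ X) : IsCompact (wordMap φ I '' A) :=
  hA.image_of_continuousOn ((h.lipschitzOnWith I).continuousOn.mono hAX)

theorem dist_le_cylDiam (h : IsQuasiSelfSimilar φ X L r) {I : List ι}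
    {x y : EuclideanSpace ℝ (Fin d)} (hx : x ∈ wordMap φ I '' X) (hy : y ∈ wordMap φ I '' X) :
    dist x y ≤ cylDiam φ X I :=
  Metric.dist_le_diam_of_mem (h.isCompact_image I h.isCompact subset_rfl).isBounded hx hy

theorem nontrivial_index (h : IsQuasiSelfSimilar φ X L r) : Nontrivial ι := by
  by_contra hne
  have hsub : Subsingleton ι := not_nontrivial_iff_subsingleton.1 hne
  -- with one map only, `X = φ_I(X)` has diameter at most `diam X * r`
  obtain ⟨x, hx⟩ := h.nonempty
  rw [h.eq_iUnion] at hx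
  obtain ⟨i, -⟩ := mem_iUnion.1 hx
  have hXi : φ i '' X = X := by
    conv_rhs => rw [h.eq_iUnion]
    exact subset_antisymm (subset_iUnion (fun j => φ j '' X) i)
      (iUnion_subset fun j => by rw [Subsingleton.elim j i])
  have h1 := h.cylDiam_le [i]
  simp only [cylDiam, wordMap, Function.comp_id, hXi, List.length_cons, List.length_nil, zero_add,
    pow_one] at h1
  have h2 := h.diam_pos
  have h3 := h.lt_one
  nlinarith

theorem disjoint_image (h : IsQuasiSelfSimilar φ X L r) (n : ℕ) (hA : A ⊆ X) :
    Pairwise (Function.onFun Disjoint fun I : Fin n → ι => wordMap φ (List.ofFn I) '' A) :=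
  pairwise_disjoint_image_wordMap h.eq_iUnion h.injOn h.separation n hA

theorem iUnion_image (h : IsQuasiSelfSimilar φ X L r) (n : ℕ) :
    ⋃ I : Fin n → ι, wordMap φ (List.ofFn I) '' X = X := by
  rw [← hutchinson_iterate_eq_iUnion, hutchinson_iterate_eq_self h.eq_iUnion]

variable [Fintype ι]

theorem sum_cylDiam_div_rpow_lt_one (h : IsQuasiSelfSimilar φ X L r) {t : ℝ}
    (hs : (dimH X).toReal < t) {n : ℕ} (hn : n ≠ 0) :
    ∑ I : Fin n → ι, (cylDiam φ X (List.ofFn I) / L) ^ t < 1 := by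
  by_contra! hcon
  have := h.nontrivial_index
  have : Nonempty (Fin n) := ⟨⟨0, Nat.pos_of_ne_zero hn⟩⟩
  have ht : 0 < t := ENNReal.toReal_nonneg.trans_lt hs
  have h0 : μH[t] X = 0 := by
    have := hausdorffMeasure_of_dimH_lt (s := X) (d := t.toNNReal)
      ((ENNReal.lt_ofReal_iff_toReal_lt (Real.dimH_ne_top X)).2 hs)
    rwa [Real.coe_toNNReal t ht.le] at this
  obtain ⟨η, hη, hη'⟩ := exists_pos_le_dist_of_pairwise_disjoint
    (S := fun I : Fin n → ι => wordMap φ (List.ofFn I) '' X)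
    (fun I => h.isCompact_image _ h.isCompact subset_rfl)
    (fun I J hIJ => h.disjoint_image n subset_rfl hIJ)
  obtain ⟨s, U, hU, hlt⟩ := exists_finite_cover_of_hausdorffMeasure_eq_zero h.isCompact ht h0
    (Real.rpow_pos_of_pos hη t)
  refine absurd hlt (not_lt.2 ?_)
  exact rpow_le_sum_diam_of_cover (ψ := fun I : Fin n → ι => wordMap φ (List.ofFn I))
    h.isCompact.isBounded h.nonempty (fun I => h.mapsTo_word _)
    (fun I => div_pos (h.cylDiam_pos _) h.pos_L) (fun I => h.lower _) hη
    (fun I J hIJ x hx y hy => hη' I J hIJ _ (mem_image_of_mem _ hx) _ (mem_image_of_mem _ hy))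
    ht.le hcon s U hU

theorem sum_cylDiam_div_rpow_le_one (h : IsQuasiSelfSimilar φ X L r) {n : ℕ} (hn : n ≠ 0) :
    ∑ I : Fin n → ι, (cylDiam φ X (List.ofFn I) / L) ^ (dimH X).toReal ≤ 1 := by
  have hc : Continuous fun t : ℝ => ∑ I : Fin n → ι, (cylDiam φ X (List.ofFn I) / L) ^ t :=
    continuous_finsetSum _ fun I _ =>
      Real.continuous_const_rpow (div_pos (h.cylDiam_pos _) h.pos_L).ne'
  refine le_of_tendsto (hc.continuousWithinAt (s := Ioi (dimH X).toReal)).tendsto ?_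
  filter_upwards [self_mem_nhdsWithin] with t ht
  exact (h.sum_cylDiam_div_rpow_lt_one ht hn).le

theorem dimH_toReal_pos (h : IsQuasiSelfSimilar φ X L r) : 0 < (dimH X).toReal := by
  refine lt_of_le_of_ne ENNReal.toReal_nonneg fun h0 => ?_
  have h1 := h.sum_cylDiam_div_rpow_le_one one_ne_zero
  have := h.nontrivial_index
  rw [← h0] at h1
  simp only [Real.rpow_zero, Finset.sum_const, Finset.card_univ, nsmul_eq_mul, mul_one] at h1
  have h2 : 1 < Fintype.card (Fin 1 → ι) := Fintype.one_lt_card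
  exact absurd h1 (not_le.2 (by exact_mod_cast h2))

/-- The sums `∑ diam(X_I) ^ s` over words of a given length stay bounded for `s = dim X`. -/
theorem sum_cylDiam_rpow_le (h : IsQuasiSelfSimilar φ X L r) {n : ℕ} (hn : n ≠ 0) :
    ∑ I : Fin n → ι, cylDiam φ X (List.ofFn I) ^ (dimH X).toReal ≤ L ^ (dimH X).toReal := by
  have h1 := h.sum_cylDiam_div_rpow_le_one hn
  simp_rw [Real.div_rpow (h.cylDiam_pos _).le h.pos_L.le] at h1
  rwa [← Finset.sum_div, div_le_one (Real.rpow_pos_of_pos h.pos_L _)] at h1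

theorem hausdorffMeasure_ne_top (h : IsQuasiSelfSimilar φ X L r) :
    μH[(dimH X).toReal] X ≠ ⊤ := by
  have hr : Tendsto (fun n : ℕ => ENNReal.ofReal (Metric.diam X * r ^ n)) atTop (𝓝 0) := by
    rw [← ENNReal.ofReal_zero]
    refine ENNReal.tendsto_ofReal ?_
    simpa using (tendsto_pow_atTop_nhds_zero_of_lt_one h.pos.le h.lt_one).const_mul (Metric.diam X)
  have hed : ∀ I : List ι, Metric.ediam (wordMap φ I '' X) = ENNReal.ofReal (cylDiam φ X I) :=
    fun I => by
      rw [cylDiam, Metric.diam, ENNReal.ofReal_toReal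
        (h.isCompact_image I h.isCompact subset_rfl).isBounded.ediam_ne_top]
  have h1 := Measure.hausdorffMeasure_le_liminf_sum (dimH X).toReal X _ hr
    (fun (n : ℕ) (I : Fin n → ι) => wordMap φ (List.ofFn I) '' X)
    (Eventually.of_forall fun n I => by
      rw [hed]
      exact ENNReal.ofReal_le_ofReal (by simpa using h.cylDiam_le (List.ofFn I)))
    (Eventually.of_forall fun n => (h.iUnion_image n).superset)
  refine ne_top_of_le_ne_top (ENNReal.ofReal_ne_top (r := L ^ (dimH X).toReal)) (h1.trans ?_)
  refine liminf_le_of_frequently_le' (Eventually.frequently ?_)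
  filter_upwards [eventually_ne_atTop 0] with n hn
  simp_rw [hed, ENNReal.ofReal_rpow_of_pos (h.cylDiam_pos _)]
  rw [← ENNReal.ofReal_sum_of_nonneg fun I _ => Real.rpow_nonneg (h.cylDiam_pos _).le _]
  exact ENNReal.ofReal_le_ofReal (h.sum_cylDiam_rpow_le hn)

end IsQuasiSelfSimilar

/-! ### The Hausdorff measure on the attractor -/

/-- Hausdorff measure on `X` in the dimension of `X`. -/
noncomputable def attractorMeasure {d : ℕ} (X : Set (EuclideanSpace ℝ (Fin d))) :
    Measure (EuclideanSpace ℝ (Fin d)) :=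
  (Measure.hausdorffMeasure (dimH X).toReal).restrict X

namespace IsQuasiSelfSimilar

variable {d : ℕ} {ι : Type*} {φ : ι → EuclideanSpace ℝ (Fin d) → EuclideanSpace ℝ (Fin d)}
  {X A B : Set (EuclideanSpace ℝ (Fin d))} {L r : ℝ}

theorem attractorMeasure_apply (h : IsQuasiSelfSimilar φ X L r) (hA : A ⊆ X) :
    attractorMeasure X A = μH[(dimH X).toReal] A := by
  rw [attractorMeasure, Measure.restrict_apply' h.isCompact.measurableSet,
    inter_eq_self_of_subset_left hA]

theorem hutchinson_iterate_subset (h : IsQuasiSelfSimilar φ X L r) (n : ℕ) (hA : A ⊆ X) :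
    (hutchinson φ)^[n] A ⊆ X := by
  conv_rhs => rw [← hutchinson_iterate_eq_self h.eq_iUnion n]
  exact hutchinson_iterate_mono n hA

theorem image_word_subset (h : IsQuasiSelfSimilar φ X L r) (I : List ι) (hA : A ⊆ X) :
    wordMap φ I '' A ⊆ X :=
  (image_mono hA).trans (h.mapsTo_word I).image_subset

theorem one_le_L_rpow (h : IsQuasiSelfSimilar φ X L r) : 1 ≤ L ^ (dimH X).toReal :=
  Real.one_le_rpow h.one_le ENNReal.toReal_nonneg

theorem exists_cylinder (h : IsQuasiSelfSimilar φ X L r) (n : ℕ) {x : EuclideanSpace ℝ (Fin d)}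
    (hx : x ∈ X) : ∃ I : List ι, I.length = n ∧ x ∈ wordMap φ I '' X := by
  rw [← hutchinson_iterate_eq_self h.eq_iUnion n] at hx
  exact mem_hutchinson_iterate.1 hx

theorem mem_image_append (h : IsQuasiSelfSimilar φ X L r) (I : List ι)
    {y : EuclideanSpace ℝ (Fin d)} (hy : y ∈ X) :
    ∃ j, y ∈ φ j '' X ∧ ∀ v ∈ φ j '' X, wordMap φ I v ∈ wordMap φ (I ++ [j]) '' X := by
  rw [h.eq_iUnion] at hy
  obtain ⟨j, hj⟩ := mem_iUnion.1 hy
  refine ⟨j, hj, ?_⟩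
  rintro _ ⟨v, hv, rfl⟩
  exact ⟨v, hv, by simp [wordMap_append, wordMap]⟩

theorem exists_cylDiam_lt (h : IsQuasiSelfSimilar φ X L r) {t : ℝ} (ht : 0 < t) :
    ∃ n : ℕ, ∀ I : List ι, I.length = n → cylDiam φ X I < t := by
  have h1 : Tendsto (fun n : ℕ => Metric.diam X * r ^ n) atTop (𝓝 0) := by
    simpa using (tendsto_pow_atTop_nhds_zero_of_lt_one h.pos.le h.lt_one).const_mul (Metric.diam X)
  obtain ⟨n, hn⟩ := (h1.eventually (gt_mem_nhds ht)).exists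
  exact ⟨n, fun I hI => (h.cylDiam_le I).trans_lt (hI ▸ hn)⟩

theorem cylDiam_mul_le (h : IsQuasiSelfSimilar φ X L r) (I J : List ι) :
    cylDiam φ X I / L * cylDiam φ X J ≤ cylDiam φ X (I ++ J) := by
  have h0 : 0 < cylDiam φ X I / L := div_pos (h.cylDiam_pos I) h.pos_L
  rw [mul_comm, ← le_div_iff₀ h0]
  refine Metric.diam_le_of_forall_dist_le (div_nonneg (h.cylDiam_pos _).le h0.le) ?_
  rintro _ ⟨x, hx, rfl⟩ _ ⟨y, hy, rfl⟩
  rw [le_div_iff₀ h0, mul_comm]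
  refine (h.lower I _ (h.mapsTo_word J hx) _ (h.mapsTo_word J hy)).trans (h.dist_le_cylDiam ?_ ?_)
  · exact ⟨x, hx, by simp [wordMap_append]⟩
  · exact ⟨y, hy, by simp [wordMap_append]⟩

variable [Fintype ι]

/-- By strong separation, the part of `X` in a ball lies in a cylinder of comparable diameter. -/
theorem exists_cylinder_superset_closedBall (h : IsQuasiSelfSimilar φ X L r) :
    ∃ κ : ℝ, 0 < κ ∧ ∀ x ∈ X, ∀ t, 0 < t → ∃ I : List ι,
      X ∩ Metric.closedBall x t ⊆ wordMap φ I '' X ∧ κ * cylDiam φ X I ≤ t := by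
  obtain ⟨η, hη, hη'⟩ := exists_pos_le_dist_of_pairwise_disjoint (S := fun i : ι => φ i '' X)
    (fun i => by simpa [wordMap] using h.isCompact_image [i] h.isCompact subset_rfl) h.separation
  have hL := h.pos_L
  refine ⟨η / L, by positivity, fun x hx t ht => ?_⟩
  have key : ∀ n : ℕ, ∃ I : List ι, x ∈ wordMap φ I '' X ∧
      X ∩ Metric.closedBall x t ⊆ wordMap φ I '' X ∧
      (η / L * cylDiam φ X I ≤ t ∨ I.length = n) := by
    intro n
    induction n with
    | zero => exact ⟨[], by simpa [wordMap] using hx, by simp [wordMap], Or.inr rfl⟩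
    | succ n ih =>
      obtain ⟨I, hxI, hI, hor⟩ := ih
      by_cases hle : η / L * cylDiam φ X I ≤ t
      · exact ⟨I, hxI, hI, Or.inl hle⟩
      have hn := hor.resolve_left hle
      obtain ⟨y, hy, rfl⟩ := hxI
      obtain ⟨j, hj, hjI⟩ := h.mem_image_append I hy
      refine ⟨I ++ [j], hjI y hj, ?_, Or.inr (by simp [hn])⟩
      intro w hw
      obtain ⟨v, hv, rfl⟩ := hI hw
      obtain ⟨l, hl, hlI⟩ := h.mem_image_append I hv
      have hlj : l = j := by
        by_contra hne
        have h1 := h.lower I v hv y hy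
        have h2 := hη' l j hne v hl y hj
        have h3 : dist (wordMap φ I v) (wordMap φ I y) ≤ t := hw.2
        have h4 : cylDiam φ X I / L * η ≤ cylDiam φ X I / L * dist v y :=
          mul_le_mul_of_nonneg_left h2 (div_nonneg (h.cylDiam_pos I).le hL.le)
        have h5 : η / L * cylDiam φ X I = cylDiam φ X I / L * η := by ring
        exact hle (by linarith)
      exact hlj ▸ hlI v hl
  obtain ⟨n, hn⟩ := h.exists_cylDiam_lt (t := t / (η / L)) (by positivity)
  obtain ⟨I, -, hI, hor⟩ := key n
  refine ⟨I, hI, hor.elim id fun hlen => ?_⟩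
  have h1 := (hn I hlen).le
  rwa [le_div_iff₀ (by positivity), mul_comm] at h1

/-- Every ball of radius at most `1` about a point of `X` contains a cylinder of comparable
diameter. -/
theorem exists_cylinder_subset_closedBall (h : IsQuasiSelfSimilar φ X L r) :
    ∃ c : ℝ, 0 < c ∧ ∀ x ∈ X, ∀ t, 0 < t → t ≤ 1 → ∃ I : List ι,
      wordMap φ I '' X ⊆ Metric.closedBall x t ∧ c * t ≤ cylDiam φ X I := by
  have := h.nontrivial_index
  have hL := h.pos_L
  obtain ⟨i₀, hi₀⟩ := Finite.exists_min fun i : ι => cylDiam φ X [i]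
  have hβ : 0 < cylDiam φ X [i₀] / L := div_pos (h.cylDiam_pos _) hL
  refine ⟨min (Metric.diam X) (cylDiam φ X [i₀] / L), lt_min h.diam_pos hβ,
    fun x hx t ht ht1 => ?_⟩
  set c := min (Metric.diam X) (cylDiam φ X [i₀] / L)
  have key : ∀ n : ℕ, ∃ I : List ι, x ∈ wordMap φ I '' X ∧ c * t ≤ cylDiam φ X I ∧
      (cylDiam φ X I ≤ t ∨ I.length = n) := by
    intro n
    induction n with
    | zero =>
      refine ⟨[], by simpa [wordMap] using hx, ?_, Or.inr rfl⟩
      have h1 : c ≤ cylDiam φ X [] := by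
        rw [cylDiam, wordMap, image_id]
        exact min_le_left _ _
      have h2 := (h.cylDiam_pos []).le
      nlinarith
    | succ n ih =>
      obtain ⟨I, hxI, hI, hor⟩ := ih
      by_cases hle : cylDiam φ X I ≤ t
      · exact ⟨I, hxI, hI, Or.inl hle⟩
      have hn := hor.resolve_left hle
      obtain ⟨y, hy, rfl⟩ := hxI
      obtain ⟨j, hj, hjI⟩ := h.mem_image_append I hy
      refine ⟨I ++ [j], hjI y hj, ?_, Or.inr (by simp [hn])⟩
      calc c * t ≤ cylDiam φ X [j] / L * cylDiam φ X I := by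
            refine mul_le_mul ((min_le_right _ _).trans ?_) (not_le.1 hle).le ht.le ?_
            · exact div_le_div_of_nonneg_right (hi₀ j) hL.le
            · exact div_nonneg (h.cylDiam_pos _).le hL.le
        _ = cylDiam φ X I / L * cylDiam φ X [j] := by ring
        _ ≤ _ := h.cylDiam_mul_le I [j]
  obtain ⟨n, hn⟩ := h.exists_cylDiam_lt ht
  obtain ⟨I, hxI, hI, hor⟩ := key n
  have hle : cylDiam φ X I ≤ t := hor.elim id fun hlen => (hn I hlen).le
  exact ⟨I, fun y hy => (h.dist_le_cylDiam hy hxI).trans hle, hI⟩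

theorem isFiniteMeasure (h : IsQuasiSelfSimilar φ X L r) : IsFiniteMeasure (attractorMeasure X) :=
  ⟨by
    rw [attractorMeasure, Measure.restrict_apply_univ]
    exact h.hausdorffMeasure_ne_top.lt_top⟩

theorem measureReal_image_le (h : IsQuasiSelfSimilar φ X L r) (I : List ι) (hA : A ⊆ X) :
    (attractorMeasure X).real (wordMap φ I '' A) ≤
      L ^ (dimH X).toReal * cylDiam φ X I ^ (dimH X).toReal * (attractorMeasure X).real A := by
  have := h.isFiniteMeasure
  have hs : 0 ≤ (dimH X).toReal := ENNReal.toReal_nonneg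
  have h0 := mul_nonneg h.pos_L.le (h.cylDiam_pos I).le
  have h1 := ((h.lipschitzOnWith I).mono hA).hausdorffMeasure_image_le hs
  rw [← h.attractorMeasure_apply hA, ← h.attractorMeasure_apply (h.image_word_subset I hA)] at h1
  have h2 := ENNReal.toReal_mono (ENNReal.mul_ne_top
    (ENNReal.rpow_ne_top_of_nonneg hs ENNReal.coe_ne_top) (measure_ne_top _ _)) h1
  rw [ENNReal.toReal_mul, ← ENNReal.toReal_rpow, ENNReal.coe_toReal, Real.coe_toNNReal _ h0,
    Real.mul_rpow h.pos_L.le (h.cylDiam_pos I).le] at h2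
  exact h2

theorem le_measureReal_image (h : IsQuasiSelfSimilar φ X L r) (I : List ι) (hA : A ⊆ X) :
    cylDiam φ X I ^ (dimH X).toReal * (attractorMeasure X).real A ≤
      L ^ (dimH X).toReal * (attractorMeasure X).real (wordMap φ I '' A) := by
  have := h.isFiniteMeasure
  have hs : 0 ≤ (dimH X).toReal := ENNReal.toReal_nonneg
  have hd := h.cylDiam_pos I
  have h0 : 0 ≤ L / cylDiam φ X I := div_nonneg h.pos_L.le hd.le
  have hinv : LipschitzOnWith (L / cylDiam φ X I).toNNReal (Function.invFunOn (wordMap φ I) X)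
      (wordMap φ I '' A) := by
    refine LipschitzOnWith.of_dist_le_mul ?_
    rintro _ ⟨x, hx, rfl⟩ _ ⟨y, hy, rfl⟩
    rw [(h.injOn_word I).leftInvOn_invFunOn (hA hx), (h.injOn_word I).leftInvOn_invFunOn (hA hy),
      Real.coe_toNNReal _ h0, div_mul_eq_mul_div, le_div_iff₀ hd]
    have h1 := h.lower I x (hA hx) y (hA hy)
    rw [div_mul_eq_mul_div, div_le_iff₀ h.pos_L] at h1
    linarith
  have himg : Function.invFunOn (wordMap φ I) X '' (wordMap φ I '' A) = A :=
    ((h.injOn_word I).leftInvOn_invFunOn.mono hA).image_image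
  have h1 := hinv.hausdorffMeasure_image_le hs
  rw [himg, ← h.attractorMeasure_apply hA,
    ← h.attractorMeasure_apply (h.image_word_subset I hA)] at h1
  have h2 := ENNReal.toReal_mono (ENNReal.mul_ne_top
    (ENNReal.rpow_ne_top_of_nonneg hs ENNReal.coe_ne_top) (measure_ne_top _ _)) h1
  rw [ENNReal.toReal_mul, ← ENNReal.toReal_rpow, ENNReal.coe_toReal, Real.coe_toNNReal _ h0,
    Real.div_rpow h.pos_L.le hd.le, div_mul_eq_mul_div,
    le_div_iff₀ (Real.rpow_pos_of_pos hd _), mul_comm] at h2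
  exact h2

theorem isCompact_hutchinson_iterate (h : IsQuasiSelfSimilar φ X L r) (n : ℕ) (hA : IsCompact A)
    (hAX : A ⊆ X) : IsCompact ((hutchinson φ)^[n] A) := by
  rw [hutchinson_iterate_eq_iUnion]
  exact isCompact_iUnion fun I => h.isCompact_image _ hA hAX

theorem measureReal_hutchinson_iterate (h : IsQuasiSelfSimilar φ X L r) (n : ℕ) (hA : IsCompact A)
    (hAX : A ⊆ X) : (attractorMeasure X).real ((hutchinson φ)^[n] A) =
      ∑ I : Fin n → ι, (attractorMeasure X).real (wordMap φ (List.ofFn I) '' A) := by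
  have := h.isFiniteMeasure
  rw [hutchinson_iterate_eq_iUnion]
  exact measureReal_iUnion_fintype (h.disjoint_image n hAX)
    fun I => (h.isCompact_image _ hA hAX).measurableSet

theorem measureReal_hutchinson_iterate_le (h : IsQuasiSelfSimilar φ X L r) (n : ℕ)
    (hA : IsCompact A) (hAX : A ⊆ X) : (attractorMeasure X).real ((hutchinson φ)^[n] A) ≤
      (L ^ (dimH X).toReal) ^ 2 * (attractorMeasure X).real A := by
  rcases eq_or_ne n 0 with rfl | hn
  · exact le_mul_of_one_le_left measureReal_nonneg (one_le_pow₀ h.one_le_L_rpow)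
  have hL := one_pos.trans_le h.one_le_L_rpow
  rw [h.measureReal_hutchinson_iterate n hA hAX]
  calc _ ≤ ∑ I : Fin n → ι, L ^ (dimH X).toReal * cylDiam φ X (List.ofFn I) ^ (dimH X).toReal *
        (attractorMeasure X).real A := Finset.sum_le_sum fun I _ => h.measureReal_image_le _ hAX
    _ = L ^ (dimH X).toReal * (∑ I : Fin n → ι, cylDiam φ X (List.ofFn I) ^ (dimH X).toReal) *
        (attractorMeasure X).real A := by rw [← Finset.sum_mul, ← Finset.mul_sum]
    _ ≤ L ^ (dimH X).toReal * L ^ (dimH X).toReal * (attractorMeasure X).real A := by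
        gcongr
        exact h.sum_cylDiam_rpow_le hn
    _ = _ := by ring

theorem le_measureReal_hutchinson_iterate (h : IsQuasiSelfSimilar φ X L r)
    (hpos : 0 < (attractorMeasure X).real X) (n : ℕ)
    (hA : IsCompact A) (hAX : A ⊆ X) : (attractorMeasure X).real A ≤
      (L ^ (dimH X).toReal) ^ 2 * (attractorMeasure X).real ((hutchinson φ)^[n] A) := by
  have hL := one_pos.trans_le h.one_le_L_rpow
  have h1 : 1 ≤ L ^ (dimH X).toReal *
      ∑ I : Fin n → ι, cylDiam φ X (List.ofFn I) ^ (dimH X).toReal := by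
    have h2 := h.measureReal_hutchinson_iterate n h.isCompact subset_rfl
    rw [hutchinson_iterate_eq_self h.eq_iUnion] at h2
    have h3 : (attractorMeasure X).real X ≤ ∑ I : Fin n → ι, L ^ (dimH X).toReal *
        cylDiam φ X (List.ofFn I) ^ (dimH X).toReal * (attractorMeasure X).real X :=
      h2.le.trans (Finset.sum_le_sum fun I _ => h.measureReal_image_le _ subset_rfl)
    rw [← Finset.sum_mul, ← Finset.mul_sum] at h3
    exact le_of_mul_le_mul_right (by rwa [one_mul]) hpos
  rw [h.measureReal_hutchinson_iterate n hA hAX]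
  calc (attractorMeasure X).real A = 1 * (attractorMeasure X).real A := (one_mul _).symm
    _ ≤ L ^ (dimH X).toReal *
      (∑ I : Fin n → ι, cylDiam φ X (List.ofFn I) ^ (dimH X).toReal) *
        (attractorMeasure X).real A := by gcongr
    _ = L ^ (dimH X).toReal * ∑ I : Fin n → ι, cylDiam φ X (List.ofFn I) ^ (dimH X).toReal *
        (attractorMeasure X).real A := by rw [mul_assoc, Finset.sum_mul]
    _ ≤ L ^ (dimH X).toReal * ∑ I : Fin n → ι, L ^ (dimH X).toReal *
        (attractorMeasure X).real (wordMap φ (List.ofFn I) '' A) := by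
        gcongr ?_ * ?_
        exact Finset.sum_le_sum fun I _ => h.le_measureReal_image _ hAX
    _ = _ := by rw [← Finset.mul_sum]; ring

/-- Upper Ahlfors regularity. -/
theorem exists_measureReal_closedBall_le (h : IsQuasiSelfSimilar φ X L r) :
    ∃ C : ℝ, 0 < C ∧ ∀ x ∈ X, ∀ t, 0 ≤ t →
      (attractorMeasure X).real (X ∩ Metric.closedBall x t) ≤ C * t ^ (dimH X).toReal := by
  have := h.isFiniteMeasure
  obtain ⟨κ, hκ, hcyl⟩ := h.exists_cylinder_superset_closedBall
  have hs := h.dimH_toReal_pos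
  have hL := h.pos_L
  set C := L ^ (dimH X).toReal * ((1 / κ) ^ (dimH X).toReal) * ((attractorMeasure X).real X + 1)
  have hC : 0 < C := by positivity
  have key : ∀ x ∈ X, ∀ t, 0 < t →
      (attractorMeasure X).real (X ∩ Metric.closedBall x t) ≤ C * t ^ (dimH X).toReal := by
    intro x hx t ht
    obtain ⟨I, hI, hd⟩ := hcyl x hx t ht
    have hd' : cylDiam φ X I ≤ 1 / κ * t := by
      rw [one_div, inv_mul_eq_div, le_div_iff₀ hκ, mul_comm]; exact hd
    have hdp := (h.cylDiam_pos I).le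
    calc _ ≤ (attractorMeasure X).real (wordMap φ I '' X) := measureReal_mono hI
      _ ≤ L ^ (dimH X).toReal * cylDiam φ X I ^ (dimH X).toReal * (attractorMeasure X).real X :=
        h.measureReal_image_le I subset_rfl
      _ ≤ L ^ (dimH X).toReal * (1 / κ * t) ^ (dimH X).toReal *
          ((attractorMeasure X).real X + 1) := by
        gcongr
        linarith
      _ = _ := by
        rw [Real.mul_rpow (by positivity) ht.le]
        ring
  refine ⟨C, hC, fun x hx t ht => ?_⟩
  rcases ht.eq_or_lt with rfl | ht
  · have hlim : Tendsto (fun t : ℝ => C * t ^ (dimH X).toReal) (𝓝[>] 0)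
        (𝓝 (C * 0 ^ (dimH X).toReal)) :=
      ((Real.continuous_rpow_const hs.le).const_mul C |>.tendsto 0).mono_left nhdsWithin_le_nhds
    refine ge_of_tendsto hlim ?_
    filter_upwards [self_mem_nhdsWithin] with t ht
    have ht : 0 < t := ht
    exact (measureReal_mono (inter_subset_inter_right _
      (Metric.closedBall_subset_closedBall ht.le))).trans (key x hx t ht)
  · exact key x hx t ht

/-- Lower Ahlfors regularity. -/
theorem exists_le_measureReal_closedBall (h : IsQuasiSelfSimilar φ X L r)
    (hpos : 0 < (attractorMeasure X).real X) :
    ∃ c : ℝ, 0 < c ∧ ∀ x ∈ X, ∀ t, 0 ≤ t → t ≤ 1 →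
      c * t ^ (dimH X).toReal ≤ (attractorMeasure X).real (X ∩ Metric.closedBall x t) := by
  have := h.isFiniteMeasure
  obtain ⟨κ, hκ, hcyl⟩ := h.exists_cylinder_subset_closedBall
  have hs := h.dimH_toReal_pos
  have hL := one_pos.trans_le h.one_le_L_rpow
  refine ⟨κ ^ (dimH X).toReal * (attractorMeasure X).real X / L ^ (dimH X).toReal, by positivity,
    fun x hx t ht ht1 => ?_⟩
  rcases ht.eq_or_lt with rfl | ht
  · rw [Real.zero_rpow hs.ne', mul_zero]
    exact measureReal_nonneg
  obtain ⟨I, hI, hd⟩ := hcyl x hx t ht ht1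
  rw [div_mul_eq_mul_div, div_le_iff₀ hL]
  calc _ = (κ * t) ^ (dimH X).toReal * (attractorMeasure X).real X := by
        rw [Real.mul_rpow hκ.le ht.le]; ring
    _ ≤ cylDiam φ X I ^ (dimH X).toReal * (attractorMeasure X).real X := by gcongr
    _ ≤ L ^ (dimH X).toReal * (attractorMeasure X).real (wordMap φ I '' X) :=
      h.le_measureReal_image I subset_rfl
    _ ≤ L ^ (dimH X).toReal * (attractorMeasure X).real (X ∩ Metric.closedBall x t) := by
      gcongr
      · exact measure_ne_top _ _
      · exact subset_inter (h.image_word_subset I subset_rfl) hI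
    _ = _ := mul_comm _ _

/-- Quasi-independence at distant levels: a set `A` in a ball of radius `t` and
`hutchinson^[k] B` are independent up to constants once cylinders of level `k` are small
compared with `t`. -/
theorem measureReal_inter_hutchinson_iterate_le (h : IsQuasiSelfSimilar φ X L r) (k : ℕ)
    (hBX : B ⊆ X) {z : EuclideanSpace ℝ (Fin d)} {t : ℝ}
    (hA : A ⊆ Metric.closedBall z t) (hk : Metric.diam X * r ^ k ≤ t) :
    (attractorMeasure X).real X * (attractorMeasure X).real (A ∩ (hutchinson φ)^[k] B) ≤
      (L ^ (dimH X).toReal) ^ 2 * (attractorMeasure X).real B *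
        (attractorMeasure X).real (X ∩ Metric.closedBall z (2 * t)) := by
  classical
  have := h.isFiniteMeasure
  have hL := one_pos.trans_le h.one_le_L_rpow
  set S : Finset (Fin k → ι) :=
    Finset.univ.filter fun K => (A ∩ wordMap φ (List.ofFn K) '' X).Nonempty with hS
  have hsub : A ∩ (hutchinson φ)^[k] B ⊆ ⋃ K ∈ S, wordMap φ (List.ofFn K) '' B := by
    rintro x ⟨hxA, hx⟩
    rw [hutchinson_iterate_eq_iUnion] at hx
    obtain ⟨K, hK⟩ := mem_iUnion.1 hx
    exact mem_iUnion₂.2 ⟨K, Finset.mem_filter.2 ⟨Finset.mem_univ _, x, hxA, image_mono hBX hK⟩, hK⟩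
  have hball : (⋃ K ∈ S, wordMap φ (List.ofFn K) '' X) ⊆ X ∩ Metric.closedBall z (2 * t) := by
    refine iUnion₂_subset fun K hK y hy => ⟨h.image_word_subset _ subset_rfl hy, ?_⟩
    obtain ⟨-, x, hxA, hxK⟩ := Finset.mem_filter.1 hK
    have h1 := h.dist_le_cylDiam hy hxK
    have h2 := h.cylDiam_le (List.ofFn K)
    rw [List.length_ofFn] at h2
    have h3 : dist x z ≤ t := hA hxA
    have h4 := dist_triangle y x z
    exact Metric.mem_closedBall.2 (by linarith)
  have hX := measureReal_biUnion_finset (μ := attractorMeasure X) (s := S)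
    (f := fun K => wordMap φ (List.ofFn K) '' X)
    (fun K _ K' _ hne => h.disjoint_image k subset_rfl hne)
    (fun K _ => (h.isCompact_image _ h.isCompact subset_rfl).measurableSet)
  calc _ ≤ (attractorMeasure X).real X *
        ∑ K ∈ S, (attractorMeasure X).real (wordMap φ (List.ofFn K) '' B) := by
        gcongr
        exact (measureReal_mono hsub (measure_ne_top _ _)).trans (measureReal_biUnion_finset_le _ _)
    _ ≤ (attractorMeasure X).real X * ∑ K ∈ S, L ^ (dimH X).toReal *
          cylDiam φ X (List.ofFn K) ^ (dimH X).toReal * (attractorMeasure X).real B := by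
        gcongr with K
        exact h.measureReal_image_le _ hBX
    _ = L ^ (dimH X).toReal * (attractorMeasure X).real B * ∑ K ∈ S,
          cylDiam φ X (List.ofFn K) ^ (dimH X).toReal * (attractorMeasure X).real X := by
        rw [Finset.mul_sum, Finset.mul_sum]
        exact Finset.sum_congr rfl fun K _ => by ring
    _ ≤ L ^ (dimH X).toReal * (attractorMeasure X).real B * ∑ K ∈ S, L ^ (dimH X).toReal *
          (attractorMeasure X).real (wordMap φ (List.ofFn K) '' X) := by
        gcongr ?_ * ?_
        exact Finset.sum_le_sum fun K _ => h.le_measureReal_image _ subset_rfl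
    _ = (L ^ (dimH X).toReal) ^ 2 * (attractorMeasure X).real B *
          (attractorMeasure X).real (⋃ K ∈ S, wordMap φ (List.ofFn K) '' X) := by
        rw [hX, ← Finset.mul_sum]
        ring
    _ ≤ _ := by
        gcongr
        exact measure_ne_top _ _

/-- Inside a cylinder, a set of the form `hutchinson^[n] A` has the proportion of mass
that `A` has in `X`, up to constants. -/
theorem measureReal_cylinder_inter_le (h : IsQuasiSelfSimilar φ X L r) (J : List ι) {n : ℕ}
    (hn : J.length ≤ n) (hA : IsCompact A) (hAX : A ⊆ X) :
    (attractorMeasure X).real (wordMap φ J '' X ∩ (hutchinson φ)^[n] A) ≤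
      (L ^ (dimH X).toReal) ^ 3 * cylDiam φ X J ^ (dimH X).toReal *
        (attractorMeasure X).real A := by
  obtain ⟨k, rfl⟩ := Nat.exists_eq_add_of_le hn
  have hL := one_pos.trans_le h.one_le_L_rpow
  have hd := Real.rpow_pos_of_pos (h.cylDiam_pos J) (dimH X).toReal
  rw [image_inter_hutchinson_iterate h.eq_iUnion h.injOn h.separation J k hAX]
  calc _ ≤ L ^ (dimH X).toReal * cylDiam φ X J ^ (dimH X).toReal *
        (attractorMeasure X).real ((hutchinson φ)^[k] A) :=
        h.measureReal_image_le J (h.hutchinson_iterate_subset k hAX)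
    _ ≤ L ^ (dimH X).toReal * cylDiam φ X J ^ (dimH X).toReal *
        ((L ^ (dimH X).toReal) ^ 2 * (attractorMeasure X).real A) := by
        gcongr
        exact h.measureReal_hutchinson_iterate_le k hA hAX
    _ = _ := by ring

theorem le_measureReal_cylinder_inter (h : IsQuasiSelfSimilar φ X L r)
    (hpos : 0 < (attractorMeasure X).real X) (J : List ι) {n : ℕ}
    (hn : J.length ≤ n) (hA : IsCompact A) (hAX : A ⊆ X) :
    cylDiam φ X J ^ (dimH X).toReal * (attractorMeasure X).real A ≤
    (L ^ (dimH X).toReal) ^ 3 *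
      (attractorMeasure X).real (wordMap φ J '' X ∩ (hutchinson φ)^[n] A) := by
  obtain ⟨k, rfl⟩ := Nat.exists_eq_add_of_le hn
  have hL := one_pos.trans_le h.one_le_L_rpow
  have hd := Real.rpow_pos_of_pos (h.cylDiam_pos J) (dimH X).toReal
  rw [image_inter_hutchinson_iterate h.eq_iUnion h.injOn h.separation J k hAX]
  calc _ ≤ cylDiam φ X J ^ (dimH X).toReal * ((L ^ (dimH X).toReal) ^ 2 *
        (attractorMeasure X).real ((hutchinson φ)^[k] A)) := by
        gcongr
        exact h.le_measureReal_hutchinson_iterate hpos k hA hAX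
    _ = (L ^ (dimH X).toReal) ^ 2 * (cylDiam φ X J ^ (dimH X).toReal *
        (attractorMeasure X).real ((hutchinson φ)^[k] A)) := by ring
    _ ≤ (L ^ (dimH X).toReal) ^ 2 * (L ^ (dimH X).toReal *
        (attractorMeasure X).real (wordMap φ J '' ((hutchinson φ)^[k] A))) := by
        gcongr ?_ * ?_
        exact h.le_measureReal_image J (h.hutchinson_iterate_subset k hAX)
    _ = _ := by ring

/-- Zero-one law: a set that misses a fixed proportion of every cylinder is null. -/
theorem measure_eq_zero_of_cylinder_le (h : IsQuasiSelfSimilar φ X L r)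
    {E : Set (EuclideanSpace ℝ (Fin d))} (hE : MeasurableSet E) (hEX : E ⊆ X) {q : ℝ} (hq : q < 1)
    (hcyl : ∀ J : List ι, (attractorMeasure X).real (wordMap φ J '' X ∩ E) ≤
      q * (attractorMeasure X).real (wordMap φ J '' X)) :
    attractorMeasure X E = 0 := by
  classical
  have := h.isFiniteMeasure
  by_contra hne
  obtain ⟨K, hKE, hKc, hK0⟩ := hE.exists_lt_isCompact (pos_iff_ne_zero.2 hne)
  have hK0' : 0 < (attractorMeasure X).real K := ENNReal.toReal_pos hK0.ne' (measure_ne_top _ _)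
  have hq0 : 0 ≤ q := by
    have h1 := hcyl []
    have h2 : 0 < (attractorMeasure X).real X :=
      hK0'.trans_le (measureReal_mono (hKE.trans hEX))
    simp only [wordMap, image_id] at h1
    exact nonneg_of_mul_nonneg_left (measureReal_nonneg.trans h1) h2
  -- the cylinders of level `n` meeting `K` lie in a shrinking neighbourhood of `K`
  have key : ∀ n : ℕ, (attractorMeasure X).real K ≤
      q * (attractorMeasure X).real (Metric.cthickening (Metric.diam X * r ^ n) K) := by
    intro n
    set S : Finset (Fin n → ι) :=
      Finset.univ.filter fun I => (K ∩ wordMap φ (List.ofFn I) '' X).Nonempty with hS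
    have hsub : K ⊆ ⋃ I ∈ S, (wordMap φ (List.ofFn I) '' X ∩ E) := by
      intro x hx
      have hxX := hEX (hKE hx)
      rw [← h.iUnion_image n] at hxX
      obtain ⟨I, hI⟩ := mem_iUnion.1 hxX
      exact mem_iUnion₂.2 ⟨I, Finset.mem_filter.2 ⟨Finset.mem_univ _, x, hx, hI⟩, hI, hKE hx⟩
    have hball : (⋃ I ∈ S, wordMap φ (List.ofFn I) '' X) ⊆
        Metric.cthickening (Metric.diam X * r ^ n) K := by
      refine iUnion₂_subset fun I hI y hy => ?_
      obtain ⟨-, x, hxK, hxI⟩ := Finset.mem_filter.1 hI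
      have h1 := (h.dist_le_cylDiam hy hxI).trans (h.cylDiam_le (List.ofFn I))
      rw [List.length_ofFn] at h1
      exact Metric.mem_cthickening_of_dist_le y x _ _ hxK h1
    have hX := measureReal_biUnion_finset (μ := attractorMeasure X) (s := S)
      (f := fun I => wordMap φ (List.ofFn I) '' X)
      (fun K _ K' _ hne => h.disjoint_image n subset_rfl hne)
      (fun K _ => (h.isCompact_image _ h.isCompact subset_rfl).measurableSet)
    calc _ ≤ ∑ I ∈ S, (attractorMeasure X).real (wordMap φ (List.ofFn I) '' X ∩ E) :=
          (measureReal_mono hsub (measure_ne_top _ _)).trans (measureReal_biUnion_finset_le _ _)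
      _ ≤ ∑ I ∈ S, q * (attractorMeasure X).real (wordMap φ (List.ofFn I) '' X) :=
          Finset.sum_le_sum fun I _ => hcyl _
      _ = q * (attractorMeasure X).real (⋃ I ∈ S, wordMap φ (List.ofFn I) '' X) := by
          rw [hX, Finset.mul_sum]
      _ ≤ _ := by
          gcongr
          exact measure_ne_top _ _
  have hr : Tendsto (fun n : ℕ => Metric.diam X * r ^ n) atTop (𝓝 0) := by
    simpa using (tendsto_pow_atTop_nhds_zero_of_lt_one h.pos.le h.lt_one).const_mul (Metric.diam X)
  have hlim : Tendsto (fun n : ℕ => q * (attractorMeasure X).real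
      (Metric.cthickening (Metric.diam X * r ^ n) K)) atTop
      (𝓝 (q * (attractorMeasure X).real K)) :=
    (((ENNReal.tendsto_toReal (measure_ne_top _ _)).comp
      (tendsto_measure_cthickening_of_isCompact hKc)).comp hr).const_mul q
  have := ge_of_tendsto' hlim key
  nlinarith

end IsQuasiSelfSimilar

/-! ### Second moments -/

/-- The Chung–Erdős inequality. -/
theorem sq_sum_measureReal_le {Ω κ : Type*} [MeasurableSpace Ω] (μ : Measure Ω) [IsFiniteMeasure μ]
    (s : Finset κ) (F : κ → Set Ω) (hF : ∀ i, MeasurableSet (F i)) :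
    (∑ i ∈ s, μ.real (F i)) ^ 2 ≤
      μ.real (⋃ i ∈ s, F i) * ∑ i ∈ s, ∑ j ∈ s, μ.real (F i ∩ F j) := by
  set U := ⋃ i ∈ s, F i with hU
  have hUm : MeasurableSet U := Finset.measurableSet_biUnion s fun i _ => hF i
  set f : κ → Ω → ℝ := fun i => (F i).indicator 1 with hf
  set u : Ω → ℝ := U.indicator 1 with hu
  have hint : ∀ S : Set Ω, MeasurableSet S → Integrable (S.indicator (1 : Ω → ℝ)) μ := fun S hS =>
    (integrable_const (1 : ℝ)).indicator hS
  have hval : ∀ S : Set Ω, MeasurableSet S → ∫ x, S.indicator (1 : Ω → ℝ) x ∂μ = μ.real S :=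
    fun S hS => integral_indicator_one hS
  -- the second moment of `∑ 1_{F i} + c 1_U` is nonnegative for every real `c`
  have key : ∀ c : ℝ, 0 ≤ μ.real U * (c * c) + 2 * (∑ i ∈ s, μ.real (F i)) * c +
      ∑ i ∈ s, ∑ j ∈ s, μ.real (F i ∩ F j) := by
    intro c
    have hpt : ∀ x, (∑ i ∈ s, f i x + c * u x) ^ 2 = c * c * u x + 2 * c * ∑ i ∈ s, f i x +
        ∑ i ∈ s, ∑ j ∈ s, (F i ∩ F j).indicator (1 : Ω → ℝ) x := by
      intro x
      have h1 : u x * u x = u x := by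
        by_cases hx : x ∈ U <;> simp [hu, hx]
      have h2 : ∀ i ∈ s, f i x * u x = f i x := by
        intro i hi
        by_cases hx : x ∈ F i
        · have : x ∈ U := mem_iUnion₂.2 ⟨i, hi, hx⟩
          simp [hu, this]
        · simp [hf, hx]
      have h3 : ∀ i j, f i x * f j x = (F i ∩ F j).indicator (1 : Ω → ℝ) x := by
        intro i j
        by_cases hi : x ∈ F i <;> by_cases hj : x ∈ F j <;> simp [hf, hi, hj]
      have h4 : (∑ i ∈ s, f i x) * u x = ∑ i ∈ s, f i x := by
        rw [Finset.sum_mul]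
        exact Finset.sum_congr rfl h2
      have h5 : (∑ i ∈ s, f i x) * (∑ i ∈ s, f i x) =
          ∑ i ∈ s, ∑ j ∈ s, (F i ∩ F j).indicator (1 : Ω → ℝ) x := by
        rw [Finset.sum_mul_sum]
        simp_rw [h3]
      rw [← h5]
      linear_combination c * c * h1 + 2 * c * h4
    have h0 : 0 ≤ ∫ x, (∑ i ∈ s, f i x + c * u x) ^ 2 ∂μ :=
      integral_nonneg fun x => sq_nonneg _
    simp_rw [hpt] at h0
    rw [integral_add, integral_add, integral_const_mul, integral_const_mul, integral_finsetSum,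
      integral_finsetSum, hval U hUm] at h0
    · have h6 : ∀ i ∈ s, ∫ x, ∑ j ∈ s, (F i ∩ F j).indicator (1 : Ω → ℝ) x ∂μ =
          ∑ j ∈ s, μ.real (F i ∩ F j) := by
        intro i _
        rw [integral_finsetSum _ fun j _ => hint _ ((hF i).inter (hF j))]
        exact Finset.sum_congr rfl fun j _ => hval _ ((hF i).inter (hF j))
      rw [Finset.sum_congr rfl h6, Finset.sum_congr rfl fun i _ => hval _ (hF i)] at h0
      linarith
    · exact fun i _ => integrable_finsetSum _ fun j _ => hint _ ((hF i).inter (hF j))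
    · exact fun i _ => hint _ (hF i)
    · exact (hint U hUm).const_mul _
    · exact (integrable_finsetSum _ fun i _ => hint _ (hF i)).const_mul _
    · exact ((hint U hUm).const_mul _).add
        ((integrable_finsetSum _ fun i _ => hint _ (hF i)).const_mul _)
    · exact integrable_finsetSum _ fun i _ =>
        integrable_finsetSum _ fun j _ => hint _ ((hF i).inter (hF j))
  have := discrim_le_zero key
  rw [discrim] at this
  nlinarith

theorem sum_sum_le_two_mul_sum_sum_Icc {f : ℕ → ℕ → ℝ} (hf : ∀ n m, 0 ≤ f n m)
    (hsymm : ∀ n m, f n m = f m n) (N Q : ℕ) :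
    ∑ n ∈ Finset.Icc N Q, ∑ m ∈ Finset.Icc N Q, f n m ≤
      2 * ∑ n ∈ Finset.Icc N Q, ∑ m ∈ Finset.Icc n Q, f n m := by
  have h1 : ∀ n ∈ Finset.Icc N Q, ∑ m ∈ Finset.Icc N Q, (if n ≤ m then f n m else 0) =
      ∑ m ∈ Finset.Icc n Q, f n m := by
    intro n hn
    rw [← Finset.sum_filter]
    refine Finset.sum_congr ?_ fun _ _ => rfl
    ext m
    simp only [Finset.mem_filter, Finset.mem_Icc] at hn ⊢
    omega
  have h2 : ∑ n ∈ Finset.Icc N Q, ∑ m ∈ Finset.Icc N Q, f n m ≤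
      ∑ n ∈ Finset.Icc N Q, ∑ m ∈ Finset.Icc N Q, (if n ≤ m then f n m else 0) +
      ∑ n ∈ Finset.Icc N Q, ∑ m ∈ Finset.Icc N Q, (if m ≤ n then f m n else 0) := by
    rw [← Finset.sum_add_distrib]
    refine Finset.sum_le_sum fun n _ => ?_
    rw [← Finset.sum_add_distrib]
    refine Finset.sum_le_sum fun m _ => ?_
    have := hf n m
    rcases le_total n m with h | h
    · rw [if_pos h]
      split_ifs
      · linarith [hf m n]
      · linarith
    · rw [if_pos h, hsymm m n]
      split_ifs <;> linarith
  rw [Finset.sum_comm (f := fun n m => if m ≤ n then f m n else 0),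
    Finset.sum_congr rfl h1] at h2
  linarith

/-! ### The divergence and logarithm conditions -/

/-- The number of levels after which cylinders become shorter than `t` is of order
`log (1 / t)`. -/
theorem card_filter_lt_mul_pow_le {r D t : ℝ} (hr0 : 0 < r) (hr1 : r < 1) (hD : 0 < D) (ht : 0 < t)
    (ht1 : t ≤ 1) (n Q : ℕ) :
    (((Finset.Icc n Q).filter fun m => t < D * r ^ (m - n)).card : ℝ) ≤
      (|Real.log D| / Real.log (1 / r) + 1) + 1 / Real.log (1 / r) * Real.log (1 / t) := by
  have hlr : 0 < Real.log (1 / r) := Real.log_pos (by rw [lt_div_iff₀ hr0]; linarith)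
  have hlt : 0 ≤ Real.log (1 / t) := Real.log_nonneg (by rw [le_div_iff₀ ht]; linarith)
  set x := (|Real.log D| + Real.log (1 / t)) / Real.log (1 / r) with hx
  have hx0 : 0 ≤ x := by positivity
  have hsub : ((Finset.Icc n Q).filter fun m => t < D * r ^ (m - n)) ⊆
      Finset.Ico n (n + ⌈x⌉₊) := by
    intro m hm
    obtain ⟨hm, hlt⟩ := Finset.mem_filter.1 hm
    have hnm := (Finset.mem_Icc.1 hm).1
    have h1 := Real.log_lt_log ht hlt
    rw [Real.log_mul hD.ne' (by positivity), Real.log_pow] at h1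
    have h2 : ((m - n : ℕ) : ℝ) < x := by
      rw [hx, lt_div_iff₀ hlr, one_div, one_div, Real.log_inv, Real.log_inv]
      linarith [le_abs_self (Real.log D)]
    have h3 : m - n < ⌈x⌉₊ := by exact_mod_cast h2.trans_le (Nat.le_ceil x)
    exact Finset.mem_Ico.2 ⟨hnm, by omega⟩
  have h1 := Finset.card_le_card hsub
  rw [Nat.card_Ico, Nat.add_sub_cancel_left] at h1
  have h2 : (((Finset.Icc n Q).filter fun m => t < D * r ^ (m - n)).card : ℝ) ≤ ⌈x⌉₊ := by
    exact_mod_cast h1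
  have h3 := (Nat.ceil_lt_add_one hx0).le
  have h4 : x + 1 = (|Real.log D| / Real.log (1 / r) + 1) +
      1 / Real.log (1 / r) * Real.log (1 / t) := by
    rw [hx]
    ring
  linarith

/-- The hypotheses on `θ` survive discarding an initial segment, with a constant that does not
depend on the segment. -/
theorem exists_eventually_sum_mul_le_sq {θ : ℕ → ℝ} {s a b : ℝ} (hθ : ∀ n, 0 ≤ θ n) (ha : 0 ≤ a)
    (hb : 0 ≤ b) (hdiv : Tendsto (fun Q : ℕ => ∑ n ∈ Finset.Icc 1 Q, θ n ^ s) atTop atTop)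
    (hlog : (fun Q : ℕ => ∑ n ∈ Finset.Icc 1 Q, θ n ^ s * Real.log (1 / θ n)) =O[atTop]
      (fun Q : ℕ => (∑ n ∈ Finset.Icc 1 Q, θ n ^ s) ^ 2)) :
    ∃ C : ℝ, 0 < C ∧ ∀ N, 1 ≤ N → ∀ᶠ Q in atTop, 0 < ∑ n ∈ Finset.Icc N Q, θ n ^ s ∧
      ∑ n ∈ Finset.Icc N Q, θ n ^ s *
          (∑ m ∈ Finset.Icc N Q, θ m ^ s + (a + b * Real.log (1 / θ n))) ≤
        C * (∑ n ∈ Finset.Icc N Q, θ n ^ s) ^ 2 := by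
  obtain ⟨c, hc, hcO⟩ := hlog.exists_pos
  refine ⟨1 + a + 4 * b * (c + 1), by positivity, fun N hN => ?_⟩
  have hsplit : ∀ f : ℕ → ℝ, ∀ Q, N ≤ Q → ∑ n ∈ Finset.Icc 1 Q, f n =
      ∑ n ∈ Finset.Ico 1 N, f n + ∑ n ∈ Finset.Icc N Q, f n := by
    intro f Q hQ
    rw [← Finset.Ico_add_one_right_eq_Icc, ← Finset.Ico_add_one_right_eq_Icc,
      Finset.sum_Ico_consecutive f hN (by omega)]
  set s₀ := ∑ n ∈ Finset.Ico 1 N, θ n ^ s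
  set l₀ := ∑ n ∈ Finset.Ico 1 N, θ n ^ s * Real.log (1 / θ n)
  have hs₀ : 0 ≤ s₀ := Finset.sum_nonneg fun n _ => Real.rpow_nonneg (hθ n) _
  filter_upwards [hcO.bound, eventually_ge_atTop N,
    hdiv.eventually_ge_atTop (2 * s₀ + |l₀| + 2)] with Q hQ hNQ hbig
  rw [Real.norm_eq_abs, Real.norm_eq_abs, abs_of_nonneg (sq_nonneg (∑ n ∈ Finset.Icc 1 Q, θ n ^ s)),
    hsplit _ Q hNQ, hsplit _ Q hNQ] at hQ
  rw [hsplit _ Q hNQ] at hbig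
  set S := ∑ n ∈ Finset.Icc N Q, θ n ^ s
  set l := ∑ n ∈ Finset.Icc N Q, θ n ^ s * Real.log (1 / θ n)
  have hl₀ := abs_nonneg l₀
  have hS1 : 1 ≤ S := by linarith
  have h1 : l₀ + l ≤ c * (s₀ + S) ^ 2 := (le_abs_self _).trans hQ
  have h2 : (s₀ + S) ^ 2 ≤ 4 * S ^ 2 := by nlinarith
  have h3 : -l₀ ≤ 4 * S ^ 2 := by nlinarith [neg_le_abs l₀]
  have h4 : l ≤ 4 * (c + 1) * S ^ 2 := by
    have := mul_le_mul_of_nonneg_left h2 hc.le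
    linarith
  refine ⟨by linarith, ?_⟩
  have h5 : ∑ n ∈ Finset.Icc N Q, θ n ^ s * (S + (a + b * Real.log (1 / θ n))) =
      S * S + a * S + b * l := by
    have : ∀ n, θ n ^ s * (S + (a + b * Real.log (1 / θ n))) =
        θ n ^ s * S + θ n ^ s * a + b * (θ n ^ s * Real.log (1 / θ n)) := fun n => by ring
    simp_rw [this]
    rw [Finset.sum_add_distrib, Finset.sum_add_distrib, ← Finset.mul_sum, ← Finset.sum_mul,
      ← Finset.sum_mul]
    ring
  rw [h5]
  have h6 := mul_le_mul_of_nonneg_left h4 hb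
  have h7 : a * S ≤ a * S ^ 2 := by
    gcongr
    nlinarith
  linarith

/-! ### The limsup set has full measure -/

namespace IsQuasiSelfSimilar

variable {d : ℕ} {ι : Type*} {φ : ι → EuclideanSpace ℝ (Fin d) → EuclideanSpace ℝ (Fin d)}
  {X : Set (EuclideanSpace ℝ (Fin d))} {L r : ℝ}

/-- The set `⋃_{|I| = n} φ_I (X ∩ B(z, t / L))`; the factor `1 / L` puts its piece in `X_I`
inside the ball `B(φ_I(z), diam(X_I) t)`. -/
def target (φ : ι → EuclideanSpace ℝ (Fin d) → EuclideanSpace ℝ (Fin d))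
    (X : Set (EuclideanSpace ℝ (Fin d))) (L : ℝ) (z : EuclideanSpace ℝ (Fin d)) (n : ℕ) (t : ℝ) :
    Set (EuclideanSpace ℝ (Fin d)) :=
  (hutchinson φ)^[n] (X ∩ Metric.closedBall z (t / L))

theorem isCompact_inter_closedBall (h : IsQuasiSelfSimilar φ X L r) (z : EuclideanSpace ℝ (Fin d))
    (t : ℝ) : IsCompact (X ∩ Metric.closedBall z t) :=
  h.isCompact.inter_right Metric.isClosed_closedBall

theorem exists_word_of_mem_target (h : IsQuasiSelfSimilar φ X L r)
    {z : EuclideanSpace ℝ (Fin d)} (hz : z ∈ X) {n : ℕ} {t : ℝ} {x : EuclideanSpace ℝ (Fin d)}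
    (hx : x ∈ target φ X L z n t) :
    ∃ I : List ι, I.length = n ∧ x ∈ Metric.closedBall (wordMap φ I z) (cylDiam φ X I * t) := by
  obtain ⟨I, hI, y, ⟨hyX, hy⟩, rfl⟩ := mem_hutchinson_iterate.1 hx
  refine ⟨I, hI, Metric.mem_closedBall.2 ((h.upper I y hyX z hz).trans ?_)⟩
  have h1 : dist y z ≤ t / L := hy
  have hL := h.pos_L
  have hd := h.cylDiam_pos I
  calc L * cylDiam φ X I * dist y z ≤ L * cylDiam φ X I * (t / L) := by gcongr
    _ = _ := by field_simp

variable [Fintype ι]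

theorem isCompact_target (h : IsQuasiSelfSimilar φ X L r) (z : EuclideanSpace ℝ (Fin d)) (n : ℕ)
    (t : ℝ) : IsCompact (target φ X L z n t) :=
  h.isCompact_hutchinson_iterate n (h.isCompact_inter_closedBall z _) inter_subset_left

/-- Uniform mass estimates for the targets within a cylinder: each has relative mass comparable
to `t ^ s`, and two of them are quasi-independent if their levels are far enough apart. -/
theorem exists_measureReal_target_bounds (h : IsQuasiSelfSimilar φ X L r)
    (hpos : 0 < (attractorMeasure X).real X) {z : EuclideanSpace ℝ (Fin d)} (hz : z ∈ X) :
    ∃ c C : ℝ, 0 < c ∧ 0 < C ∧ ∀ J : List ι, ∀ n, J.length ≤ n → ∀ t, 0 ≤ t →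
      (t ≤ 1 → c * (cylDiam φ X J ^ (dimH X).toReal * t ^ (dimH X).toReal) ≤
        (attractorMeasure X).real (wordMap φ J '' X ∩ target φ X L z n t)) ∧
      (attractorMeasure X).real (wordMap φ J '' X ∩ target φ X L z n t) ≤
        C * (cylDiam φ X J ^ (dimH X).toReal * t ^ (dimH X).toReal) ∧
      ∀ k u, 0 ≤ u → Metric.diam X * r ^ k ≤ t →
        (attractorMeasure X).real ((wordMap φ J '' X ∩ target φ X L z n t) ∩
          (wordMap φ J '' X ∩ target φ X L z (n + k) u)) ≤
        C * (cylDiam φ X J ^ (dimH X).toReal * t ^ (dimH X).toReal) * u ^ (dimH X).toReal := by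
  have := h.isFiniteMeasure
  obtain ⟨Cb, hCb, hup⟩ := h.exists_measureReal_closedBall_le
  obtain ⟨cb, hcb, hlow⟩ := h.exists_le_measureReal_closedBall hpos
  have hL := h.pos_L
  have hΛ := one_pos.trans_le h.one_le_L_rpow
  have hs := h.dimH_toReal_pos
  set s := (dimH X).toReal
  set Λ := L ^ s
  set M := (attractorMeasure X).real X
  have hdiv_le : ∀ t : ℝ, 0 ≤ t → t / L ≤ t := fun t ht => div_le_self ht h.one_le
  have hA : ∀ t, 0 ≤ t →
      (attractorMeasure X).real (X ∩ Metric.closedBall z (t / L)) ≤ Cb * t ^ s := fun t ht =>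
    (hup z hz _ (by positivity)).trans (by gcongr; exact hdiv_le t ht)
  refine ⟨cb / Λ ^ 4, Λ ^ 3 * Cb + Λ ^ 5 * Cb ^ 2 * 2 ^ s / M, by positivity, by positivity,
    fun J n hn t ht => ?_⟩
  have hd := Real.rpow_pos_of_pos (h.cylDiam_pos J) s
  set p := cylDiam φ X J ^ s
  have hts : 0 ≤ t ^ s := by positivity
  refine ⟨fun ht1 => ?_, ?_, fun k u hu hk => ?_⟩
  · have h1 := h.le_measureReal_cylinder_inter hpos J hn (h.isCompact_inter_closedBall z (t / L))
      inter_subset_left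
    have h2 := hlow z hz (t / L) (by positivity) ((hdiv_le t ht).trans ht1)
    rw [Real.div_rpow ht hL.le] at h2
    calc cb / Λ ^ 4 * (p * t ^ s) = p * (cb * (t ^ s / Λ)) / Λ ^ 3 := by
          field_simp
      _ ≤ p * (attractorMeasure X).real (X ∩ Metric.closedBall z (t / L)) / Λ ^ 3 := by gcongr
      _ ≤ _ := by
          rw [div_le_iff₀ (by positivity), mul_comm _ (Λ ^ 3)]
          exact h1
  · calc _ ≤ Λ ^ 3 * p * (attractorMeasure X).real (X ∩ Metric.closedBall z (t / L)) :=
          h.measureReal_cylinder_inter_le J hn (h.isCompact_inter_closedBall z (t / L))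
            inter_subset_left
      _ ≤ Λ ^ 3 * p * (Cb * t ^ s) := by gcongr; exact hA t ht
      _ = Λ ^ 3 * Cb * (p * t ^ s) := by ring
      _ ≤ _ := by
          gcongr
          exact le_add_of_nonneg_right (by positivity)
  · set A := X ∩ Metric.closedBall z (t / L) with hAdef
    set B := X ∩ Metric.closedBall z (u / L) with hBdef
    have hBk := h.hutchinson_iterate_subset k (inter_subset_left : B ⊆ X)
    have hAc : IsCompact A := h.isCompact_inter_closedBall z _
    have hBc : IsCompact ((hutchinson φ)^[k] B) :=
      h.isCompact_hutchinson_iterate k (h.isCompact_inter_closedBall z _) inter_subset_left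
    have hset : (wordMap φ J '' X ∩ target φ X L z n t) ∩
        (wordMap φ J '' X ∩ target φ X L z (n + k) u) =
        wordMap φ J '' X ∩ (hutchinson φ)^[n] (A ∩ (hutchinson φ)^[k] B) := by
      rw [← inter_inter_distrib_left, target, target, Function.iterate_add_apply,
        hutchinson_iterate_inter h.eq_iUnion h.injOn h.separation n inter_subset_left hBk]
    have h1 := h.measureReal_inter_hutchinson_iterate_le k (inter_subset_left : B ⊆ X)
      (t := t) (z := z) (A := A)
      (inter_subset_right.trans (Metric.closedBall_subset_closedBall (hdiv_le t ht))) hk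
    have h2 := hup z hz (2 * t) (by positivity)
    have h3 : (attractorMeasure X).real (A ∩ (hutchinson φ)^[k] B) ≤
        Λ ^ 2 * (Cb * u ^ s) * (Cb * (2 * t) ^ s) / M := by
      rw [le_div_iff₀ hpos, mul_comm]
      refine h1.trans ?_
      gcongr
      exact hA u hu
    rw [hset]
    calc _ ≤ Λ ^ 3 * p * (attractorMeasure X).real (A ∩ (hutchinson φ)^[k] B) :=
          h.measureReal_cylinder_inter_le J hn (hAc.inter hBc)
            (inter_subset_left.trans inter_subset_left)
      _ ≤ Λ ^ 3 * p * (Λ ^ 2 * (Cb * u ^ s) * (Cb * (2 * t) ^ s) / M) := by gcongr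
      _ = Λ ^ 5 * Cb ^ 2 * 2 ^ s / M * (p * t ^ s) * u ^ s := by
          rw [Real.mul_rpow zero_le_two ht]
          ring
      _ ≤ _ := by
          gcongr
          exact le_add_of_nonneg_left (by positivity)

/-- The targets of levels beyond any `N` cover a fixed proportion of every cylinder. -/
theorem exists_proportion_le (h : IsQuasiSelfSimilar φ X L r)
    (hpos : 0 < (attractorMeasure X).real X) {z : EuclideanSpace ℝ (Fin d)} (hz : z ∈ X)
    {θ : ℕ → ℝ} (hθ : ∀ n, 0 ≤ θ n)
    (hdiv : Tendsto (fun Q : ℕ => ∑ n ∈ Finset.Icc 1 Q, θ n ^ (dimH X).toReal) atTop atTop)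
    (hlog : (fun Q : ℕ => ∑ n ∈ Finset.Icc 1 Q, θ n ^ (dimH X).toReal * Real.log (1 / θ n))
      =O[atTop] (fun Q : ℕ => (∑ n ∈ Finset.Icc 1 Q, θ n ^ (dimH X).toReal) ^ 2)) :
    ∃ c : ℝ, 0 < c ∧ ∀ (J : List ι) (N : ℕ), 1 ≤ N → J.length ≤ N → (∀ n, N ≤ n → θ n ≤ 1) →
      c * (attractorMeasure X).real (wordMap φ J '' X) ≤
        (attractorMeasure X).real (wordMap φ J '' X ∩ ⋃ n ≥ N, target φ X L z n (θ n)) := by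
  have := h.isFiniteMeasure
  obtain ⟨c, C, hc, hC, hbd⟩ := h.exists_measureReal_target_bounds hpos hz
  have hΛ := one_pos.trans_le h.one_le_L_rpow
  have hs := h.dimH_toReal_pos
  set s := (dimH X).toReal
  set Λ := L ^ s
  set M := (attractorMeasure X).real X
  set D := Metric.diam X
  have hD : 0 < D := h.diam_pos
  have hlr : 0 < Real.log (1 / r) := Real.log_pos (by
    rw [lt_div_iff₀ h.pos]; linarith [h.lt_one])
  set a := |Real.log D| / Real.log (1 / r) + 1
  set b := 1 / Real.log (1 / r)
  have ha : 0 ≤ a := by positivity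
  have hb : 0 ≤ b := by positivity
  obtain ⟨C', hC', hev⟩ := exists_eventually_sum_mul_le_sq hθ ha hb hdiv hlog
  refine ⟨c ^ 2 / (2 * C * C') / (Λ * M), by positivity, fun J N hN hJN hθ1 => ?_⟩
  obtain ⟨Q, hS, hQ⟩ := (hev N hN).exists
  have hd := Real.rpow_pos_of_pos (h.cylDiam_pos J) s
  set p := cylDiam φ X J ^ s with hp
  set S := ∑ n ∈ Finset.Icc N Q, θ n ^ s
  set G : ℕ → Set (EuclideanSpace ℝ (Fin d)) := fun n =>
    wordMap φ J '' X ∩ target φ X L z n (θ n) with hG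
  have hGm : ∀ n, MeasurableSet (G n) := fun n =>
    (h.isCompact_image J h.isCompact subset_rfl).measurableSet.inter
      (h.isCompact_target z n _).measurableSet
  -- one row of the second moment: nearby levels are counted, distant ones are quasi-independent
  have hrow : ∀ n ∈ Finset.Icc N Q, ∑ m ∈ Finset.Icc n Q, (attractorMeasure X).real (G n ∩ G m) ≤
      C * p * (θ n ^ s * (S + (a + b * Real.log (1 / θ n)))) := by
    intro n hn
    have hNn := (Finset.mem_Icc.1 hn).1
    obtain ⟨-, hup, hind⟩ := hbd J n (hJN.trans hNn) (θ n) (hθ n)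
    have hθs : 0 ≤ θ n ^ s := Real.rpow_nonneg (hθ n) _
    have hterm : ∀ m ∈ Finset.Icc n Q, (attractorMeasure X).real (G n ∩ G m) ≤
        C * p * θ n ^ s * (θ m ^ s + if θ n < D * r ^ (m - n) then 1 else 0) := by
      intro m hm
      obtain ⟨k, rfl⟩ := Nat.exists_eq_add_of_le (Finset.mem_Icc.1 hm).1
      have hθm : 0 ≤ θ (n + k) ^ s := Real.rpow_nonneg (hθ _) _
      rw [Nat.add_sub_cancel_left]
      split_ifs with hk
      · calc _ ≤ (attractorMeasure X).real (G n) :=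
              measureReal_mono inter_subset_left (measure_ne_top _ _)
          _ ≤ C * (p * θ n ^ s) := hup
          _ = C * p * θ n ^ s * 1 := by ring
          _ ≤ _ := by gcongr; linarith
      · calc _ ≤ C * (p * θ n ^ s) * θ (n + k) ^ s := hind k _ (hθ _) (not_lt.1 hk)
          _ = _ := by ring
    refine (Finset.sum_le_sum hterm).trans ?_
    rw [← Finset.mul_sum, Finset.sum_add_distrib, Finset.sum_boole, mul_assoc (C * p)]
    refine mul_le_mul_of_nonneg_left ?_ (by positivity)
    rcases (hθ n).eq_or_lt with h0 | h0
    · rw [← h0, Real.zero_rpow hs.ne', zero_mul, zero_mul]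
    · refine mul_le_mul_of_nonneg_left (add_le_add ?_ ?_) hθs
      · exact Finset.sum_le_sum_of_subset_of_nonneg (Finset.Icc_subset_Icc_left hNn)
          fun m _ _ => Real.rpow_nonneg (hθ m) _
      · exact card_filter_lt_mul_pow_le h.pos h.lt_one hD h0 (hθ1 n hNn) n Q
  have hsecond : ∑ n ∈ Finset.Icc N Q, ∑ m ∈ Finset.Icc N Q,
      (attractorMeasure X).real (G n ∩ G m) ≤ 2 * C * C' * p * S ^ 2 := by
    calc _ ≤ 2 * ∑ n ∈ Finset.Icc N Q, ∑ m ∈ Finset.Icc n Q,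
          (attractorMeasure X).real (G n ∩ G m) :=
          sum_sum_le_two_mul_sum_sum_Icc (fun n m => measureReal_nonneg)
            (fun n m => by rw [inter_comm]) N Q
      _ ≤ 2 * (C * p * (C' * S ^ 2)) := by
          rw [mul_le_mul_iff_right₀ two_pos]
          refine (Finset.sum_le_sum hrow).trans ?_
          rw [← Finset.mul_sum]
          gcongr
      _ = _ := by ring
  have hfirst : c * p * S ≤ ∑ n ∈ Finset.Icc N Q, (attractorMeasure X).real (G n) := by
    rw [Finset.mul_sum]
    refine Finset.sum_le_sum fun n hn => ?_
    have hNn := (Finset.mem_Icc.1 hn).1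
    have := (hbd J n (hJN.trans hNn) (θ n) (hθ n)).1 (hθ1 n hNn)
    rwa [← mul_assoc] at this
  have hCE := sq_sum_measureReal_le (attractorMeasure X) (Finset.Icc N Q) G hGm
  set V := (attractorMeasure X).real (⋃ n ∈ Finset.Icc N Q, G n)
  have hVp : c ^ 2 / (2 * C * C') * p ≤ V := by
    have h1 : (c * p * S) ^ 2 ≤ V * (2 * C * C' * p * S ^ 2) :=
      (pow_le_pow_left₀ (by positivity) hfirst 2).trans (hCE.trans
        (mul_le_mul_of_nonneg_left hsecond measureReal_nonneg))
    have h2 : 0 < p * S ^ 2 := by positivity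
    have h3 : (c ^ 2 * p) * (p * S ^ 2) ≤ (V * (2 * C * C')) * (p * S ^ 2) := by linarith
    have h4 := le_of_mul_le_mul_right h3 h2
    rw [div_mul_eq_mul_div, div_le_iff₀ (by positivity)]
    exact h4
  have hVle : V ≤ (attractorMeasure X).real
      (wordMap φ J '' X ∩ ⋃ n ≥ N, target φ X L z n (θ n)) := by
    refine measureReal_mono (iUnion₂_subset fun n hn => ?_) (measure_ne_top _ _)
    exact inter_subset_inter_right _
      (subset_iUnion₂ (s := fun n (_ : n ≥ N) => target φ X L z n (θ n)) n
        (Finset.mem_Icc.1 hn).1)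
  have hcyl := h.measureReal_image_le J (subset_rfl : X ⊆ X)
  calc _ ≤ c ^ 2 / (2 * C * C') / (Λ * M) * (Λ * p * M) := by gcongr
    _ = c ^ 2 / (2 * C * C') * p := by field_simp
    _ ≤ _ := hVp.trans hVle

/-- Almost every point of `X` lies in targets of arbitrarily high level. -/
theorem measure_diff_iUnion_target (h : IsQuasiSelfSimilar φ X L r)
    (hpos : 0 < (attractorMeasure X).real X) {z : EuclideanSpace ℝ (Fin d)} (hz : z ∈ X)
    {θ : ℕ → ℝ} (hθ : ∀ n, 0 ≤ θ n) (hθ1 : ∀ᶠ n in atTop, θ n ≤ 1)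
    (hdiv : Tendsto (fun Q : ℕ => ∑ n ∈ Finset.Icc 1 Q, θ n ^ (dimH X).toReal) atTop atTop)
    (hlog : (fun Q : ℕ => ∑ n ∈ Finset.Icc 1 Q, θ n ^ (dimH X).toReal * Real.log (1 / θ n))
      =O[atTop] (fun Q : ℕ => (∑ n ∈ Finset.Icc 1 Q, θ n ^ (dimH X).toReal) ^ 2)) (N : ℕ) :
    attractorMeasure X (X \ ⋃ n ≥ N, target φ X L z n (θ n)) = 0 := by
  have := h.isFiniteMeasure
  obtain ⟨c, hc, hprop⟩ := h.exists_proportion_le hpos hz hθ hdiv hlog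
  obtain ⟨N₀, hN₀⟩ := eventually_atTop.1 hθ1
  have hUm : MeasurableSet (⋃ n ≥ N, target φ X L z n (θ n)) :=
    MeasurableSet.iUnion fun n => MeasurableSet.iUnion fun _ =>
      (h.isCompact_target z n _).measurableSet
  refine h.measure_eq_zero_of_cylinder_le (h.isCompact.measurableSet.diff hUm) sdiff_subset
    (q := 1 - c) (by linarith) fun J => ?_
  set K := max (max N N₀) (max 1 J.length) with hK
  have h1 := hprop J K (by omega) (by omega) fun n hn => hN₀ n (by omega)
  have h2 : (⋃ n ≥ K, target φ X L z n (θ n)) ⊆ ⋃ n ≥ N, target φ X L z n (θ n) :=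
    iUnion₂_subset fun n hn => subset_iUnion₂ (s := fun n (_ : n ≥ N) => target φ X L z n (θ n)) n
      (by omega)
  have h3 : (attractorMeasure X).real (wordMap φ J '' X ∩ ⋃ n ≥ K, target φ X L z n (θ n)) ≤
      (attractorMeasure X).real (wordMap φ J '' X ∩ ⋃ n ≥ N, target φ X L z n (θ n)) :=
    measureReal_mono (inter_subset_inter_right _ h2) (measure_ne_top _ _)
  have h4 := measureReal_inter_add_sdiff (μ := attractorMeasure X)
    (s := wordMap φ J '' X) hUm
  have h5 : wordMap φ J '' X ∩ (X \ ⋃ n ≥ N, target φ X L z n (θ n)) =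
      wordMap φ J '' X \ ⋃ n ≥ N, target φ X L z n (θ n) := by
    rw [← inter_sdiff_assoc, inter_eq_self_of_subset_left (h.image_word_subset J subset_rfl)]
  rw [h5]
  linarith

end IsQuasiSelfSimilar

theorem List.infinite_of_forall_exists_length {α : Type*} {S : Set (List α)}
    (h : ∀ N : ℕ, ∃ I ∈ S, N ≤ I.length) : S.Infinite := by
  intro hfin
  obtain ⟨B, hB⟩ := (hfin.image List.length).bddAbove
  obtain ⟨I, hI, hlen⟩ := h (B + 1)
  have := hB (mem_image_of_mem _ hI)
  omega

theorem mainTheorem2 {d : ℕ} {ι : Type*} [Fintype ι]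
    (φ : ι → EuclideanSpace ℝ (Fin d) → EuclideanSpace ℝ (Fin d))
    (Y X : Set (EuclideanSpace ℝ (Fin d)))
    (hφ : IsConformalIFS φ Y) (hX : IsAttractor φ Y X) (hsep : StrongSeparation φ X)
    (z : EuclideanSpace ℝ (Fin d)) (hz : z ∈ X)
    (θ : ℕ → ℝ) (hθ : ∀ n, 0 ≤ θ n)
    (hdiv : Tendsto
      (fun Q : ℕ => ∑ n ∈ Finset.Icc 1 Q, ∑ I : Fin n → ι,
        (cylDiam φ X (List.ofFn I) * θ n) ^ (dimH X).toReal) atTop atTop)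
    (hlog :
      (fun Q : ℕ => ∑ n ∈ Finset.Icc 1 Q, θ n ^ (dimH X).toReal * Real.log (1 / θ n))
        =O[atTop]
      (fun Q : ℕ => (∑ n ∈ Finset.Icc 1 Q, θ n ^ (dimH X).toReal) ^ 2)) :
    ∀ᵐ x ∂(Measure.hausdorffMeasure (dimH X).toReal :
        Measure (EuclideanSpace ℝ (Fin d))),
      x ∈ X → x ∈ limsupSet φ X (fun I => cylDiam φ X I * θ I.length) z := by
  -- it suffices to find a suitable word of length at least `N`, for every `N ≥ 1`
  have hsuff : ∀ x ∈ X, (∀ N : ℕ, 1 ≤ N → ∃ I : List ι, N ≤ I.length ∧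
      x ∈ Metric.closedBall (wordMap φ I z) (cylDiam φ X I * θ I.length)) →
      x ∈ limsupSet φ X (fun I => cylDiam φ X I * θ I.length) z := by
    intro x hx hN
    refine ⟨hx, List.infinite_of_forall_exists_length fun N => ?_⟩
    obtain ⟨I, hI, hxI⟩ := hN (N + 1) (by omega)
    refine ⟨I, ⟨?_, hxI⟩, by omega⟩
    rintro rfl
    simp at hI
  rcases X.subsingleton_or_nontrivial with hsub | hnt
  · -- if `X` is a point, every cylinder is equal to `X`
    obtain ⟨i⟩ : Nonempty ι := by
      have hz' := hz
      rw [hX.eq_iUnion] at hz'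
      exact ⟨(mem_iUnion.1 hz').choose⟩
    have hmaps : ∀ i, MapsTo (φ i) X X := fun i a ha => by
      rw [hX.eq_iUnion]; exact mem_iUnion.2 ⟨i, mem_image_of_mem _ ha⟩
    refine Eventually.of_forall fun x hx => hsuff x hx fun N _ =>
      ⟨List.replicate N i, by simp, Metric.mem_closedBall.2 ?_⟩
    rw [hsub hx (mapsTo_wordMap hmaps _ hz), dist_self]
    exact mul_nonneg Metric.diam_nonneg (hθ _)
  obtain ⟨L, r, h⟩ := hX.exists_isQuasiSelfSimilar hφ hsep hnt
  by_cases hθ1 : ∀ᶠ n in atTop, θ n ≤ 1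
  swap
  · -- if `θ n ≥ 1`, the balls of level `n` contain the cylinders
    refine Eventually.of_forall fun x hx => hsuff x hx fun N _ => ?_
    obtain ⟨n, hn, hNn⟩ :=
      ((not_eventually.1 hθ1).and_eventually (eventually_ge_atTop N)).exists
    obtain ⟨I, hI, hxI⟩ := h.exists_cylinder n hx
    refine ⟨I, hI ▸ hNn, Metric.mem_closedBall.2
      ((h.dist_le_cylDiam hxI (mem_image_of_mem _ hz)).trans ?_)⟩
    rw [hI]
    exact le_mul_of_one_le_right (h.cylDiam_pos I).le (not_le.1 hn).le
  have := h.isFiniteMeasure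
  rcases (measureReal_nonneg (μ := attractorMeasure X) (s := X)).eq_or_lt with h0 | hpos
  · -- a null `X` (which does not occur, but this is not needed) leaves nothing to prove
    have h0' : μH[(dimH X).toReal] X = 0 := by
      rw [← h.attractorMeasure_apply subset_rfl]
      exact (measureReal_eq_zero_iff (measure_ne_top _ _)).1 h0.symm
    filter_upwards [measure_eq_zero_iff_ae_notMem.1 h0'] with x hxX hx
    exact absurd hx hxX
  have hdiv' : Tendsto (fun Q : ℕ => ∑ n ∈ Finset.Icc 1 Q, θ n ^ (dimH X).toReal)
      atTop atTop := by
    have hΛ := one_pos.trans_le h.one_le_L_rpow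
    refine tendsto_atTop_mono (fun Q => ?_) (hdiv.const_mul_atTop (inv_pos.2 hΛ))
    rw [inv_mul_le_iff₀ hΛ, Finset.mul_sum]
    refine Finset.sum_le_sum fun n hn => ?_
    have hn0 : n ≠ 0 := by
      have := (Finset.mem_Icc.1 hn).1
      omega
    simp_rw [Real.mul_rpow (h.cylDiam_pos _).le (hθ n)]
    rw [← Finset.sum_mul]
    exact mul_le_mul_of_nonneg_right (h.sum_cylDiam_rpow_le hn0) (Real.rpow_nonneg (hθ n) _)
  have hae : ∀ᵐ x ∂(Measure.hausdorffMeasure (dimH X).toReal :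
      Measure (EuclideanSpace ℝ (Fin d))), ∀ N : ℕ,
      x ∉ X \ ⋃ n ≥ N, IsQuasiSelfSimilar.target φ X L z n (θ n) := by
    refine ae_all_iff.2 fun N => measure_eq_zero_iff_ae_notMem.1 ?_
    rw [← h.attractorMeasure_apply sdiff_subset]
    exact h.measure_diff_iUnion_target hpos hz hθ hθ1 hdiv' hlog N
  filter_upwards [hae] with x hxN hx
  refine hsuff x hx fun N _ => ?_
  have h1 : x ∈ ⋃ n ≥ N, IsQuasiSelfSimilar.target φ X L z n (θ n) := by
    by_contra hcon
    exact hxN N ⟨hx, hcon⟩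
  obtain ⟨n, hn, hxn⟩ := mem_iUnion₂.1 h1
  obtain ⟨I, rfl, hI⟩ := h.exists_word_of_mem_target hz hxn
  exact ⟨I, hn, hI⟩
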